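/- An \emph{ai-semiring} is an algebra $(S,+,\cdot)$ with two associative binary operations such that $+$ is commutative and idempotent ($x+x=x$) and $\cdot$ distributes over $+$ on both sides; $(S,\cdot)$ is its multiplicative reduct. A semigroup is a \emph{block-group} if, for all its elements $e,f$, each of the conditions $ef=e^2=e\ \&\ fe=f^2=f$ and $ef=f^2=f\ \&\ fe=e^2=e$ implies $e=f$. A \emph{subgroup} of a semigroup is a subsemigroup that is a group under the restricted multiplication. An \emph{identity} is a formal equality $s=t$ of two terms built from variables $x_0,x_1,x_2,\dots$ by means of $+$ and $\cdot$; it holds in an ai-semiring if $s$ and $t$ take equal values under every substitution of elements for the variables. A \emph{finite identity basis} of an ai-semiring $\mathcal S$ is a finite set $\Sigma$ of identities holding in $\mathcal S$ such that every identity of $\mathcal S$ holds in every ai-semiring satisfying $\Sigma$. Let $\mathcal B_2^1$ be the ai-semiring formed by the six matrices \[ \begin{pmatrix}0&0\\0&0\end{pmatrix},\ \begin{pmatrix}1&0\\0&1\end{pmatrix},\ \begin{pmatrix}0&1\\0&0\end{pmatrix},\ \begin{pmatrix}0&0\\1&0\end{pmatrix},\ \begin{pmatrix}1&0\\0&0\end{pmatrix},\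 \begin{pmatrix}0&0\\0&1\end{pmatrix} \] with the usual matrix product as multiplication and the entry-wise (Hadamard) product as addition. \textbf{Theorem.} Let $\mathcal S=(S,+,\cdot)$ be a finite ai-semiring whose multiplicative reduct is a block-group all of whose subgroups are solvable. If all identities of $\mathcal S$ hold in $\mathcal B_2^1$, then $\mathcal S$ has no finite identity basis. -/

import Mathlib

universe u

/-- An additively idempotent semiring: an algebra with two associative binary operations `+`, `*`
such that `*` distributes over `+` on both sides and `+` is commutative and idempotent.
No neutral or zero elements are required. -/
class AISemiring (S : Type u) extends AddCommSemigroup S, Semigroup S, Distrib S where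
  add_idem : ∀ a : S, a + a = a

/-- Terms of type `(2,2)` over the countably infinite set of variables `x₀, x₁, x₂, …`. -/
inductive SemiringTerm : Type
  | var : ℕ → SemiringTerm
  | add : SemiringTerm → SemiringTerm → SemiringTerm
  | mul : SemiringTerm → SemiringTerm → SemiringTerm

/-- The value of a term under a substitution of elements of `S` for the variables. -/
def SemiringTerm.eval {S : Type u} [Add S] [Mul S] (τ : ℕ → S) : SemiringTerm → S
  | .var i => τ i
  | .add s t => s.eval τ + t.eval τ
  | .mul s t => s.eval τ * t.eval τ

/-- An identity `lhs = rhs` between terms. -/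
structure SemiringIdentity : Type where
  lhs : SemiringTerm
  rhs : SemiringTerm

/-- The identity `p` holds in `S`. -/
def SemiringIdentity.HoldsIn (p : SemiringIdentity) (S : Type u) [Add S] [Mul S] : Prop :=
  ∀ τ : ℕ → S, p.lhs.eval τ = p.rhs.eval τ

/-- The set of all identities of `S`. -/
def identitiesOf (S : Type u) [Add S] [Mul S] : Set SemiringIdentity :=
  {p | p.HoldsIn S}

/-- `p` is a consequence of `B` (within ai-semirings): every ai-semiring satisfying all identities
in `B` satisfies `p`. It is enough to look at ai-semirings in `Type`, because the relatively free
ai-semiring on countably many generators defined by `B` is one of them. -/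
def SemiringIdentity.FollowsFrom (p : SemiringIdentity) (B : Set SemiringIdentity) : Prop :=
  ∀ (T : Type) [AISemiring T], (∀ b ∈ B, b.HoldsIn T) → p.HoldsIn T

/-- `B` is an identity basis of `S`: it consists of identities of `S`, and all identities of `S`
follow from it. The laws of ai-semirings are understood to be available for free; as there are only
finitely many of them and they hold in `S`, the existence of a finite basis does not depend on
this convention. -/
def IsIdentityBasis (B : Set SemiringIdentity) (S : Type u) [AISemiring S] : Prop :=
  B ⊆ identitiesOf S ∧ ∀ p ∈ identitiesOf S, p.FollowsFrom B

/-- `S` admits a finite identity basis. -/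
def HasFiniteIdentityBasis (S : Type u) [AISemiring S] : Prop :=
  ∃ B : Set SemiringIdentity, B.Finite ∧ IsIdentityBasis B S

/-- A block-group: a semigroup satisfying the implications
`ef = e² = e & fe = f² = f → e = f` and `ef = f² = f & fe = e² = e → e = f`. -/
def IsBlockGroup (S : Type u) [Semigroup S] : Prop :=
  (∀ e f : S, e * f = e → e * e = e → f * e = f → f * f = f → e = f) ∧
  (∀ e f : S, e * f = f → f * f = f → f * e = e → e * e = e → e = f)

/-- Every subgroup of the semigroup `S`, that is, every subsemigroup of `S` which is a group under
the multiplication of `S`, is solvable. -/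
def HasSolvableSubgroups (S : Type u) [Semigroup S] : Prop :=
  ∀ (H : Subsemigroup S) (G : Type u) [Group G], Nonempty (G ≃* H) → Group.IsSolvable G

/-- The six zero-one `2 × 2` matrices forming the Brandt monoid. -/
def brandtMatrices : Finset (Matrix (Fin 2) (Fin 2) ℕ) :=
  {!![0, 0; 0, 0], !![1, 0; 0, 1], !![0, 1; 0, 0], !![0, 0; 1, 0], !![1, 0; 0, 0], !![0, 0; 0, 1]}

/-- The carrier of the 6-element Brandt monoid. -/
def BrandtMonoid : Type := {A : Matrix (Fin 2) (Fin 2) ℕ // A ∈ brandtMatrices}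

namespace BrandtMonoid

theorem mul_mem : ∀ A ∈ brandtMatrices, ∀ B ∈ brandtMatrices, A * B ∈ brandtMatrices := by
  decide

theorem hadamard_mem :
    ∀ A ∈ brandtMatrices, ∀ B ∈ brandtMatrices, Matrix.hadamard A B ∈ brandtMatrices := by
  decide

theorem mul_hadamard : ∀ A ∈ brandtMatrices, ∀ B ∈ brandtMatrices, ∀ C ∈ brandtMatrices,
    A * Matrix.hadamard B C = Matrix.hadamard (A * B) (A * C) := by
  decide

theorem hadamard_mul : ∀ A ∈ brandtMatrices, ∀ B ∈ brandtMatrices, ∀ C ∈ brandtMatrices,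
    Matrix.hadamard A B * C = Matrix.hadamard (A * C) (B * C) := by
  decide

theorem hadamard_self : ∀ A ∈ brandtMatrices, Matrix.hadamard A A = A := by
  decide

/-- The ai-semiring on the 6-element Brandt monoid: multiplication is the usual matrix product,
addition is the Hadamard (entry-wise) product. -/
instance : AISemiring BrandtMonoid where
  add A B := ⟨Matrix.hadamard A.1 B.1, hadamard_mem _ A.2 _ B.2⟩
  mul A B := ⟨A.1 * B.1, mul_mem _ A.2 _ B.2⟩
  add_assoc A B C := Subtype.ext (Matrix.hadamard_assoc A.1 B.1 C.1)
  add_comm A B := Subtype.ext (Matrix.hadamard_comm A.1 B.1)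
  mul_assoc A B C := Subtype.ext (Matrix.mul_assoc A.1 B.1 C.1)
  left_distrib A B C := Subtype.ext (mul_hadamard _ A.2 _ B.2 _ C.2)
  right_distrib A B C := Subtype.ext (hadamard_mul _ A.2 _ B.2 _ C.2)
  add_idem A := Subtype.ext (hadamard_self _ A.2)

end BrandtMonoid

/-! ### Finite block-groups -/

section BlockGroup

variable {Mo : Type u} [Monoid Mo]

/-- `f` is an idempotent generating the same left ideal as `x`. -/
def LeftIdem (x f : Mo) : Prop := f * f = f ∧ x * f = x ∧ ∃ y, y * x = f

/-- `d` is an idempotent generating the same right ideal as `x`. -/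
def RightIdem (x d : Mo) : Prop := d * d = d ∧ d * x = x ∧ ∃ y, x * y = d

theorem IsBlockGroup.absorb_right (hb : IsBlockGroup Mo) {e f x : Mo} (he : e * e = e)
    (hf : f * f = f) (h : e * f * x = e) : e * f = e ∧ f * e = e := by
  have hk : f * x * e * (f * x * e) = f * x * e := by
    calc f * x * e * (f * x * e) = f * x * (e * f * x) * e := by simp only [mul_assoc]
      _ = f * x * e := by rw [h, mul_assoc (f * x), he]
  have h1 : e = f * x * e := by
    refine hb.1 e (f * x * e) ?_ he ?_ hk
    · calc e * (f * x * e) = e * f * x * e := by simp only [mul_assoc]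
        _ = e := by rw [h, he]
    · rw [mul_assoc, he]
  have h2 : f * e = e := by
    calc f * e = f * (f * x * e) := by rw [← h1]
      _ = f * f * x * e := by simp only [mul_assoc]
      _ = e := by rw [hf, ← h1]
  have h3 : e = e * f := by
    refine hb.2 e (e * f) ?_ ?_ ?_ he
    · rw [← mul_assoc, he]
    · rw [mul_assoc, ← mul_assoc f, h2, ← mul_assoc, he]
    · rw [mul_assoc, h2, he]
  exact ⟨h3.symm, h2⟩

theorem IsBlockGroup.absorb_left (hb : IsBlockGroup Mo) {e f x : Mo} (he : e * e = e)
    (hf : f * f = f) (h : x * (f * e) = e) : e * f = e ∧ f * e = e := by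
  have hk : e * x * f * (e * x * f) = e * x * f := by
    calc e * x * f * (e * x * f) = e * (x * (f * e)) * x * f := by simp only [mul_assoc]
      _ = e * x * f := by rw [h, he]
  have h1 : e = e * x * f := by
    refine hb.2 e (e * x * f) ?_ hk ?_ he
    · rw [← mul_assoc, ← mul_assoc, he]
    · calc e * x * f * e = e * (x * (f * e)) := by simp only [mul_assoc]
        _ = e := by rw [h, he]
  have h2 : e * f = e := by
    calc e * f = e * x * f * f := by rw [← h1]
      _ = e := by rw [mul_assoc (e * x), hf, ← h1]
  have h3 : e = f * e := by
    refine hb.1 e (f * e) ?_ he ?_ ?_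
    · rw [← mul_assoc, h2, he]
    · rw [mul_assoc, he]
    · rw [mul_assoc, ← mul_assoc e, h2, he]
  exact ⟨h2, h3.symm⟩

theorem LeftIdem.unique (hb : IsBlockGroup Mo) {x f g : Mo} (hf : LeftIdem x f)
    (hg : LeftIdem x g) : f = g := by
  obtain ⟨hff, hxf, y, rfl⟩ := hf
  obtain ⟨hgg, hxg, z, rfl⟩ := hg
  refine hb.1 _ _ ?_ hff ?_ hgg
  · rw [mul_assoc, hxg]
  · rw [mul_assoc, hxf]

theorem RightIdem.unique (hb : IsBlockGroup Mo) {x f g : Mo} (hf : RightIdem x f)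
    (hg : RightIdem x g) : f = g := by
  obtain ⟨hff, hxf, y, rfl⟩ := hf
  obtain ⟨hgg, hxg, z, rfl⟩ := hg
  refine hb.2 _ _ ?_ hgg ?_ hff
  · rw [← mul_assoc, hxf]
  · rw [← mul_assoc, hxg]

theorem LeftIdem.exists_rightIdem {x f : Mo} (h : LeftIdem x f) : ∃ d, RightIdem x d := by
  obtain ⟨hff, hxf, y, rfl⟩ := h
  refine ⟨x * y, ?_, ?_, y, rfl⟩
  · rw [mul_assoc, ← mul_assoc y, ← mul_assoc x, hxf]
  · rw [mul_assoc, hxf]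

theorem RightIdem.exists_leftIdem {x d : Mo} (h : RightIdem x d) : ∃ f, LeftIdem x f := by
  obtain ⟨hdd, hdx, y, rfl⟩ := h
  refine ⟨y * x, ?_, ?_, y, rfl⟩
  · rw [mul_assoc, ← mul_assoc x, hdx]
  · rw [← mul_assoc, hdx]

theorem pow_sandwich {s u w : Mo} (h : u * s * w = s) (n : ℕ) : u ^ n * s * w ^ n = s := by
  induction n with
  | zero => simp
  | succ n ih =>
    rw [pow_succ u, pow_succ' w]
    calc u ^ n * u * s * (w * w ^ n) = u ^ n * (u * s * w) * w ^ n := by simp only [mul_assoc]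
      _ = s := by rw [h, ih]

/-- Right stability of finite monoids. -/
theorem exists_mul_right_eq {n : ℕ} (hn : 0 < n) (hid : ∀ x : Mo, x ^ n * x ^ n = x ^ n)
    {s a u w : Mo} (h : u * (s * a) * w = s) : ∃ z, s * a * z = s := by
  have h' : u * s * (a * w) = s := by simpa only [mul_assoc] using h
  have h1 := pow_sandwich h' n
  have h2 : u ^ n * s = s := by
    conv_lhs => rw [← h1]
    rw [← mul_assoc, ← mul_assoc, hid, h1]
  rw [h2] at h1
  obtain ⟨m, rfl⟩ := Nat.exists_eq_succ_of_ne_zero hn.ne'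
  rw [Nat.succ_eq_add_one, pow_succ'] at h1
  exact ⟨w * (a * w) ^ m, by simpa only [mul_assoc] using h1⟩

/-- Left stability of finite monoids. -/
theorem exists_mul_left_eq {n : ℕ} (hn : 0 < n) (hid : ∀ x : Mo, x ^ n * x ^ n = x ^ n)
    {s a u w : Mo} (h : u * (a * s) * w = s) : ∃ z, z * (a * s) = s := by
  have h' : (u * a) * s * w = s := by simpa only [mul_assoc] using h
  have h1 := pow_sandwich h' n
  have h2 : s * w ^ n = s := by
    conv_lhs => rw [← h1]
    rw [mul_assoc, hid, h1]
  rw [mul_assoc, h2] at h1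
  obtain ⟨m, rfl⟩ := Nat.exists_eq_succ_of_ne_zero hn.ne'
  rw [Nat.succ_eq_add_one, pow_succ] at h1
  exact ⟨(u * a) ^ m * u, by simpa only [mul_assoc] using h1⟩

/-- An element `a` dividing-equivalent to a product `a * y * a` is regular. -/
theorem exists_leftIdem_of_repeat {n : ℕ} (hn : 0 < n) (hid : ∀ x : Mo, x ^ n * x ^ n = x ^ n)
    {a y u w : Mo} (h : u * (a * y * a) * w = a) : ∃ f, LeftIdem a f := by
  obtain ⟨z₁, h1⟩ := exists_mul_right_eq (s := a) (a := y * a) (u := u) (w := w) hn hid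
    (by simpa only [mul_assoc] using h)
  obtain ⟨z₂, h2⟩ := exists_mul_left_eq (s := a) (a := a * y) (u := u) (w := w) hn hid h
  have hb : y * a * (y * a) * z₁ = y * a := by
    calc y * a * (y * a) * z₁ = y * (a * (y * a) * z₁) := by simp only [mul_assoc]
      _ = y * a := by rw [h1]
  set b := y * a with hbdef
  have h3 := pow_sandwich (u := b) (s := b) (w := z₁) hb n
  have h4 : b ^ n * b = b := by
    calc b ^ n * b = b ^ n * (b ^ n * b * z₁ ^ n) := by rw [h3]
      _ = b := by rw [← mul_assoc, ← mul_assoc, hid, h3]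
  have h5 : b * b ^ n = b := by rw [← pow_succ', pow_succ, h4]
  refine ⟨b ^ n, hid b, ?_, ?_⟩
  · have h2' : z₂ * a * b = a := by rw [hbdef]; simpa only [mul_assoc] using h2
    calc a * b ^ n = z₂ * a * (b * b ^ n) := by rw [← mul_assoc, h2']
      _ = a := by rw [h5, h2']
  · obtain ⟨m, rfl⟩ := Nat.exists_eq_succ_of_ne_zero hn.ne'
    exact ⟨b ^ m * y, by rw [Nat.succ_eq_add_one, pow_succ, mul_assoc]⟩

/-- In a block-group, if right multiplication of a regular element by an idempotent can be
undone, then it does nothing. -/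
theorem LeftIdem.mul_idem_eq (hb : IsBlockGroup Mo) {s f a z : Mo} (hf : LeftIdem s f)
    (ha : a * a = a) (hz : s * a * z = s) : s * a = s ∧ f * a = f := by
  obtain ⟨hff, hsf, y, rfl⟩ := hf
  have : y * s * a * z = y * s := by
    calc y * s * a * z = y * (s * a * z) := by simp only [mul_assoc]
      _ = _ := by rw [hz]
  have h := (hb.absorb_right hff ha this).1
  refine ⟨?_, h⟩
  conv_lhs => rw [← hsf, mul_assoc, h]
  exact hsf

/-- In a block-group, if `s * a` generates the same right ideal as `s` and the same left ideal
as `a`, then the left idempotent of `s` is the right idempotent of `a`. -/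
theorem LeftIdem.mul_step (hb : IsBlockGroup Mo) {s f a g r z z' : Mo} (hf : LeftIdem s f)
    (hg : RightIdem a g) (hr : LeftIdem a r) (hz : s * a * z = s) (hz' : z' * (s * a) = a) :
    f = g ∧ LeftIdem (s * a) r := by
  obtain ⟨hff, hsf, y, hy⟩ := hf
  obtain ⟨hgg, hga, y', hy'⟩ := hg
  obtain ⟨hrr, har, y'', hy''⟩ := hr
  have h1 : f * g * (a * z) = f := by
    calc f * g * (a * z) = f * (g * a) * z := by simp only [mul_assoc]
      _ = y * (s * a * z) := by rw [hga, ← hy]; simp only [mul_assoc]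
      _ = f := by rw [hz, hy]
  have h2 : z' * s * (f * g) = g := by
    calc z' * s * (f * g) = z' * (s * f) * g := by simp only [mul_assoc]
      _ = z' * (s * a) * y' := by rw [hsf, ← hy']; simp only [mul_assoc]
      _ = g := by rw [hz', hy']
  have h3 := hb.absorb_right hff hgg h1
  have h4 := hb.absorb_left hgg hff h2
  refine ⟨h3.1.symm.trans h4.2, hrr, ?_, y'' * z', ?_⟩
  · rw [mul_assoc, har]
  · rw [mul_assoc, hz', hy'']

/-- If an idempotent `e` is right divisible through a product of idempotents, it absorbs all. -/
theorem IsBlockGroup.absorb_list (hb : IsBlockGroup Mo) {e : Mo} (he : e * e = e) :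
    ∀ (l : List Mo) (z : Mo), (∀ a ∈ l, a * a = a) → e * l.prod * z = e → ∀ a ∈ l, e * a = e
  | [], _, _, _, a, ha => by simp at ha
  | b :: l, z, hl, h, a, ha => by
    have h1 : e * b = e := by
      refine (hb.absorb_right (x := l.prod * z) he (hl b (by simp)) ?_).1
      simpa [mul_assoc] using h
    rcases List.mem_cons.1 ha with rfl | ha
    · exact h1
    · refine IsBlockGroup.absorb_list hb he l z (fun c hc => hl c (by simp [hc])) ?_ a ha
      rw [List.prod_cons, ← mul_assoc, h1] at h
      exact h

end BlockGroup

/-! ### Block words and their values in finite block-groups -/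

/-- The product `g 0 * g 1 * ⋯ * g (n - 1)`. -/
def seqProd {Mo : Type*} [Monoid Mo] (g : ℕ → Mo) (n : ℕ) : Mo := ((List.range n).map g).prod

/-- The sequence `W` starts with `M` blocks of length `N`, each being an arrangement of the
letters `0, …, N - 1`. -/
def IsBlockWord (W : ℕ → ℕ) (M N : ℕ) : Prop :=
  ∀ j < M, Set.BijOn (fun s => W (j * N + s)) (Set.Iio N) (Set.Iio N)

section SeqProd

variable {Mo : Type*} [Monoid Mo]

@[simp] theorem seqProd_zero (g : ℕ → Mo) : seqProd g 0 = 1 := rfl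

theorem seqProd_succ (g : ℕ → Mo) (n : ℕ) : seqProd g (n + 1) = seqProd g n * g n :=
  List.prod_range_succ g n

theorem seqProd_add (g : ℕ → Mo) (m n : ℕ) :
    seqProd g (m + n) = seqProd g m * seqProd (fun i => g (m + i)) n := by
  induction n with
  | zero => simp
  | succ n ih => rw [← add_assoc, seqProd_succ, ih, seqProd_succ, mul_assoc]

theorem mul_seqProd_of_fixed {s : Mo} {g : ℕ → Mo} (n : ℕ) (h : ∀ i < n, s * g i = s) :
    s * seqProd g n = s := by
  induction n with
  | zero => simp
  | succ n ih => rw [seqProd_succ, ← mul_assoc, ih fun i hi => h i (by omega), h n (by omega)]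

theorem map_seqProd {Mo' : Type*} [Monoid Mo'] (φ : Mo →* Mo') (g : ℕ → Mo) (n : ℕ) :
    φ (seqProd g n) = seqProd (fun i => φ (g i)) n := by
  induction n with
  | zero => simp
  | succ n ih => rw [seqProd_succ, seqProd_succ, map_mul, ih]

theorem seqProd_eq_prod {A : Type*} [CommMonoid A] (g : ℕ → A) (n : ℕ) :
    seqProd g n = ∏ i ∈ Finset.range n, g i := by
  induction n with
  | zero => simp
  | succ n ih => rw [seqProd_succ, ih, Finset.prod_range_succ]

end SeqProd

namespace IsBlockWord

variable {W : ℕ → ℕ} {M N : ℕ}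

theorem lt (hW : IsBlockWord W M N) {i : ℕ} (hi : i < M * N) : W i < N := by
  have hN : 0 < N := Nat.pos_of_ne_zero (by rintro rfl; simp at hi)
  have h1 : i / N < M := by rw [Nat.div_lt_iff_lt_mul hN]; exact hi
  have := (hW _ h1).mapsTo (x := i % N) (Nat.mod_lt _ hN)
  simpa [Nat.div_add_mod'] using this

theorem exists_index (hW : IsBlockWord W M N) {j t : ℕ} (hj : j < M) (ht : t < N) :
    ∃ s < N, W (j * N + s) = t := (hW j hj).surjOn ht

@[to_additive]
theorem prod_eq {A : Type*} [CommMonoid A] (hW : IsBlockWord W M N) (ψ : ℕ → A) :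
    ∏ i ∈ Finset.range (M * N), ψ (W i) = (∏ t ∈ Finset.range N, ψ t) ^ M := by
  have key : ∀ m ≤ M, ∏ i ∈ Finset.range (m * N), ψ (W i) = (∏ t ∈ Finset.range N, ψ t) ^ m := by
    intro m
    induction m with
    | zero => simp
    | succ m ih =>
      intro hm
      rw [Nat.succ_mul, Finset.prod_range_add, ih (by omega), pow_succ]
      congr 1
      refine Finset.prod_nbij (fun s => W (m * N + s)) ?_ ?_ ?_ fun _ _ => rfl
      · intro s hs
        simpa using (hW m hm).mapsTo (x := s) (by simpa using hs)
      · simpa [Set.InjOn] using (hW m hm).injOn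
      · simpa [Set.SurjOn] using (hW m hm).surjOn
  exact key M le_rfl

end IsBlockWord

section Values

variable {Mo : Type u} [Monoid Mo] {W : ℕ → ℕ} {M N : ℕ}

/-- Products of idempotents along a block word with many blocks are idempotent. -/
theorem IsBlockGroup.seqProd_idem [Finite Mo] (hb : IsBlockGroup Mo) (hM : 0 < M)
    (hcard : Nat.card Mo ≤ M) (hid : ∀ x : Mo, x ^ M * x ^ M = x ^ M) (hW : IsBlockWord W M N)
    {a : ℕ → Mo} (ha : ∀ t < N, a t * a t = a t) :
    seqProd (fun i => a (W i)) (M * N) * seqProd (fun i => a (W i)) (M * N) =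
      seqProd (fun i => a (W i)) (M * N) := by
  have := Fintype.ofFinite Mo
  set g : ℕ → Mo := fun i => a (W i) with hg
  have hlt : Fintype.card Mo < Fintype.card (Fin (M + 1)) := by
    rw [Fintype.card_fin, ← Nat.card_eq_fintype_card]; omega
  obtain ⟨j, j', hne, heq⟩ :=
    Fintype.exists_ne_map_eq_of_card_lt (fun j : Fin (M + 1) => seqProd g (j * N)) hlt
  wlog hjj : j < j' generalizing j j'
  · exact this j' j hne.symm heq.symm (lt_of_le_of_ne (not_lt.1 hjj) hne.symm)
  have hj'M : (j' : ℕ) ≤ M := by omega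
  have hjj : (j : ℕ) + 1 ≤ j' := hjj
  obtain ⟨r, hr⟩ := Nat.exists_eq_add_of_le hjj
  have hsplit : (j' : ℕ) * N = j * N + (N + r * N) := by rw [hr]; ring
  obtain ⟨q, hq⟩ := Nat.exists_eq_add_of_le hj'M
  have hMq : M * N = j' * N + q * N := by
    calc M * N = ((j' : ℕ) + q) * N := by rw [← hq]
      _ = _ := by ring
  set s := seqProd g (j * N) with hs
  set y := seqProd (fun i => g (j * N + i)) (N + r * N) with hy
  have hsy : s * y = s := by
    rw [hs, hy, ← seqProd_add, ← hsplit, ← heq]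
  have hsyn : ∀ m, s * y ^ m = s := by
    intro m
    induction m with
    | zero => simp
    | succ m ih => rw [pow_succ, ← mul_assoc, ih, hsy]
  obtain ⟨m, hm⟩ := Nat.exists_eq_add_of_lt hM
  have hey : y ^ M * y * y ^ m = y ^ M := by
    have : y * y ^ m = y ^ M := by rw [← pow_succ']; congr 1; omega
    rw [mul_assoc, this, hid]
  have habs := hb.absorb_list (hid y) ((List.range (N + r * N)).map fun i => g (j * N + i)) (y ^ m)
    (by
      intro b hb'
      obtain ⟨i, hi, rfl⟩ := List.mem_map.1 hb'
      exact ha _ (hW.lt (by have := List.mem_range.1 hi; omega))) hey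
  have hst : ∀ t < N, s * a t = s := by
    intro t ht
    obtain ⟨i, hi, hit⟩ := hW.exists_index (j := j) (t := t) (by omega) ht
    have h1 := habs (a t) (List.mem_map.2 ⟨i, List.mem_range.2 (by omega), by rw [hg]; simp [hit]⟩)
    conv_lhs => rw [← hsyn M, mul_assoc, h1]
    exact hsyn M
  have hv : seqProd g (M * N) = s := by
    rw [hMq, seqProd_add, ← heq]
    refine mul_seqProd_of_fixed _ fun i hi => hst _ (hW.lt ?_)
    omega
  have hss : s * seqProd g (M * N) = s :=
    mul_seqProd_of_fixed _ fun i hi => hst _ (hW.lt hi)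
  rw [hv] at hss ⊢
  exact hss

end Values

section Corner

variable {Mo : Type u} [Monoid Mo]

/-- The local submonoid `e Mo e` at an idempotent `e`. -/
def LocalMonoid (e : Mo) : Type u := {x : Mo // e * x = x ∧ x * e = x}

/-- The local submonoid at an idempotent is a monoid with neutral element `e`. -/
abbrev localMonoid {e : Mo} (he : e * e = e) : Monoid (LocalMonoid e) where
  mul x y := ⟨x.1 * y.1, by rw [← mul_assoc, x.2.1], by rw [mul_assoc, y.2.2]⟩
  one := ⟨e, he, he⟩
  mul_assoc x y z := Subtype.ext (mul_assoc x.1 y.1 z.1)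
  one_mul x := Subtype.ext x.2.1
  mul_one x := Subtype.ext x.2.2

/-- In a solvable group, a set whose members are values of a block word on the set itself
contains no element but the neutral one, provided that the number of blocks is an exponent of the
group. -/
theorem eq_one_of_mem_blockWord_values {G : Type*} [Group G] [Group.IsSolvable G] {W : ℕ → ℕ}
    {M N : ℕ} (hW : IsBlockWord W M N) (hexp : ∀ g : G, g ^ M = 1) {F : Set G}
    (hF : ∀ x ∈ F, ∃ b : ℕ → G, (∀ t, b t ∈ F) ∧ x = seqProd (fun i => b (W i)) (M * N)) :
    ∀ x ∈ F, x = 1 := by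
  set H := Subgroup.closure F with hH
  have hle : H ≤ ⁅H, H⁆ := by
    rw [hH, Subgroup.closure_le, ← hH]
    intro x hx
    obtain ⟨b, hb, hxb⟩ := hF x hx
    rw [← Subgroup.map_subtype_commutator]
    let b' : ℕ → H := fun t => ⟨b t, Subgroup.subset_closure (hb t)⟩
    refine ⟨seqProd (fun i => b' (W i)) (M * N), ?_, ?_⟩
    · rw [SetLike.mem_coe, ← Abelianization.ker_of, MonoidHom.mem_ker, map_seqProd,
        seqProd_eq_prod, hW.prod_eq fun t => Abelianization.of (b' t), ← Finset.prod_pow]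
      refine Finset.prod_eq_one fun t _ => ?_
      rw [← map_pow, show b' t ^ M = 1 from Subtype.ext (hexp (b t)), map_one]
    · rw [map_seqProd, hxb]; rfl
  by_cases hbot : H = ⊥
  · intro x hx
    have : x ∈ H := Subgroup.subset_closure hx
    rwa [hbot, Subgroup.mem_bot] at this
  · exact absurd hle (Group.IsSolvable.commutator_lt_of_ne_bot hbot).not_ge

end Corner

section Values

variable {Mo : Type u} [Monoid Mo] {W : ℕ → ℕ} {M N : ℕ}

/-- The situation along a block word whose value `v` is a nonidempotent as high as possible:
reading the word from the right idempotent `e` of `v`, the prefixes have left idempotents `F i`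
and each letter is either an idempotent, and then changes nothing, or leads from `F i` to
`F (i + 1)`. -/
theorem IsBlockGroup.exists_path (hb : IsBlockGroup Mo) (hM : 2 ≤ M)
    (hid : ∀ x : Mo, x ^ M * x ^ M = x ^ M) (hW : IsBlockWord W M N) {a : ℕ → Mo} {v : Mo}
    (hv : v = seqProd (fun i => a (W i)) (M * N))
    (hmax : ∀ t < N, a t * a t ≠ a t → ∃ u w, u * v * w = a t)
    (hex : ∃ t < N, a t * a t ≠ a t) :
    ∃ (e : Mo) (F : ℕ → Mo), RightIdem v e ∧ F 0 = e ∧ LeftIdem v (F (M * N)) ∧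
      ∀ i < M * N, (a (W i) * a (W i) = a (W i) ∧ F (i + 1) = F i ∧ F i * a (W i) = F i) ∨
        (a (W i) * a (W i) ≠ a (W i) ∧ RightIdem (a (W i)) (F i) ∧
          LeftIdem (a (W i)) (F (i + 1))) := by
  have hM0 : 0 < M := by omega
  set g : ℕ → Mo := fun i => a (W i) with hg
  set n := M * N with hn
  have hinit : ∀ i ≤ n, ∃ z, seqProd g i * z = v := fun i hi => by
    obtain ⟨d, hd⟩ := Nat.exists_eq_add_of_le hi
    exact ⟨_, by rw [hv, hd, seqProd_add]⟩
  have hreg : ∀ t < N, a t * a t ≠ a t → ∃ f, LeftIdem (a t) f := by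
    intro t ht hta
    obtain ⟨u, w, huw⟩ := hmax t ht hta
    obtain ⟨s, hs, hst⟩ := hW.exists_index (j := 0) (t := t) (by omega) ht
    obtain ⟨s', hs', hst'⟩ := hW.exists_index (j := 1) (t := t) (by omega) ht
    have h2N : 2 * N ≤ n := Nat.mul_le_mul_right N hM
    have hlt : 0 * N + s + 1 ≤ 1 * N + s' := by omega
    obtain ⟨d, hd⟩ := Nat.exists_eq_add_of_le hlt
    have hlt' : 1 * N + s' + 1 ≤ n := by omega
    obtain ⟨z, hz⟩ := hinit _ hlt'
    refine exists_leftIdem_of_repeat (y := seqProd (fun i => g (0 * N + s + 1 + i)) d)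
      (u := u * seqProd g (0 * N + s)) (w := z * w) hM0 hid ?_
    have hsplit : seqProd g (1 * N + s') =
        seqProd g (0 * N + s) * a t * seqProd (fun i => g (0 * N + s + 1 + i)) d := by
      conv_lhs => rw [hd]
      rw [seqProd_add, seqProd_succ, ← hst]
    have hlast : g (1 * N + s') = a t := by rw [← hst']
    calc _ = u * (seqProd g (1 * N + s') * g (1 * N + s') * z) * w := by
            rw [hsplit, hlast]; simp only [mul_assoc]
      _ = a t := by rw [← seqProd_succ, hz, huw]
  have hve : ∃ e, RightIdem v e := by
    obtain ⟨t, ht, hta⟩ := hex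
    obtain ⟨u, w, huw⟩ := hmax t ht hta
    obtain ⟨f, hff, haf, y, hy⟩ := hreg t ht hta
    obtain ⟨s, hs, hst⟩ := hW.exists_index (j := 0) (t := t) (by omega) ht
    have hNn : 1 * N ≤ n := Nat.mul_le_mul_right N (by omega)
    obtain ⟨z, hz⟩ := hinit (0 * N + s + 1) (by omega)
    rw [seqProd_succ] at hz
    simp only [hg, hst] at hz
    set x := seqProd g (0 * N + s)
    obtain ⟨z', hz'⟩ := exists_mul_left_eq (s := a t) (a := x) (u := u) (w := z * w) hM0 hid
      (by
        calc u * (x * a t) * (z * w) = u * (x * a t * z) * w := by simp only [mul_assoc]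
          _ = a t := by rw [hz, huw])
    have hl : LeftIdem (x * a t) f := ⟨hff, by rw [mul_assoc, haf], y * z', by
      rw [mul_assoc, hz', hy]⟩
    obtain ⟨d, hdd, hdx, q, hq⟩ := hl.exists_rightIdem
    obtain ⟨z'', hz''⟩ := exists_mul_right_eq (s := x * a t) (a := z) (u := x * u) (w := w) hM0 hid
      (by
        calc x * u * (x * a t * z) * w = x * (u * (x * a t * z) * w) := by simp only [mul_assoc]
          _ = x * a t := by rw [hz, huw])
    refine ⟨d, hdd, ?_, z'' * q, ?_⟩
    · rw [← hz, ← mul_assoc, hdx]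
    · rw [← hz, ← mul_assoc, hz'', hq]
  obtain ⟨e, hee, hev, y, hy⟩ := hve
  have hR : ∀ i ≤ n, RightIdem (e * seqProd g i) e := by
    intro i hi
    obtain ⟨z, hz⟩ := hinit i hi
    refine ⟨hee, by rw [← mul_assoc, hee], z * y, ?_⟩
    rw [mul_assoc, ← mul_assoc _ z, hz, ← mul_assoc, hev, hy]
  have hL : ∀ i, ∃ f, i ≤ n → LeftIdem (e * seqProd g i) f := fun i => by
    by_cases hi : i ≤ n
    · obtain ⟨f, hf⟩ := (hR i hi).exists_leftIdem
      exact ⟨f, fun _ => hf⟩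
    · exact ⟨1, fun h => absurd h hi⟩
  choose F hF using hL
  refine ⟨e, F, ⟨hee, hev, y, hy⟩, ?_, ?_, ?_⟩
  · refine (hF 0 (Nat.zero_le _)).unique hb ⟨hee, ?_, 1, ?_⟩ <;> simp [hee]
  · have := hF n le_rfl
    rwa [← hv, hev] at this
  · intro i hi
    have hLi := hF i hi.le
    have hLi' := hF (i + 1) hi
    obtain ⟨-, -, q, hq⟩ := hR (i + 1) hi
    have hz : e * seqProd g i * g i * (q * (e * seqProd g i)) = e * seqProd g i := by
      rw [seqProd_succ, ← mul_assoc e] at hq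
      rw [← mul_assoc _ q, hq, ← mul_assoc, hee]
    rw [seqProd_succ, ← mul_assoc] at hLi'
    by_cases hai : g i * g i = g i
    · left
      obtain ⟨h1, h2⟩ := hLi.mul_idem_eq hb hai hz
      rw [h1] at hLi'
      exact ⟨hai, hLi'.unique hb hLi, h2⟩
    · right
      have hWi := hW.lt hi
      obtain ⟨r, hr⟩ := hreg _ hWi hai
      obtain ⟨d, hd⟩ := hr.exists_rightIdem
      obtain ⟨u, w, huw⟩ := hmax _ hWi hai
      obtain ⟨p, hp⟩ := hinit (i + 1) hi
      obtain ⟨z', hz'⟩ := exists_mul_left_eq (s := g i) (a := e * seqProd g i) (u := u)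
        (w := p * w) hM0 hid (by
          calc u * (e * seqProd g i * g i) * (p * w)
              = u * (e * (seqProd g i * g i * p)) * w := by simp only [mul_assoc]
            _ = g i := by rw [← seqProd_succ, hp, hev, huw])
      obtain ⟨h1, h2⟩ := hLi.mul_step hb hd hr hz hz'
      rw [h1, hLi'.unique hb h2]
      exact ⟨hai, hd, hr⟩

/-- A nonidempotent value of a block word that is as high as possible lies in a subgroup. -/
theorem IsBlockGroup.leftIdem_of_path (hb : IsBlockGroup Mo) (hM : 2 ≤ M) (hW : IsBlockWord W M N)
    {a : ℕ → Mo} {v e : Mo} {F : ℕ → Mo} (hF0 : F 0 = e) (hFn : LeftIdem v (F (M * N)))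
    (hF : ∀ i < M * N, (a (W i) * a (W i) = a (W i) ∧ F (i + 1) = F i ∧ F i * a (W i) = F i) ∨
        (a (W i) * a (W i) ≠ a (W i) ∧ RightIdem (a (W i)) (F i) ∧
          LeftIdem (a (W i)) (F (i + 1)))) :
    LeftIdem v e := by
  classical
  let ψ : ℕ → ℤ := fun t => if a t * a t = a t then 0 else
    (if RightIdem (a t) e then 1 else 0) - (if LeftIdem (a t) e then 1 else 0)
  let δ : ℕ → ℤ := fun i => if F i = e then 1 else 0
  have hstep : ∀ i < M * N, δ i - δ (i + 1) = ψ (W i) := by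
    intro i hi
    rcases hF i hi with ⟨h1, h2, -⟩ | ⟨h1, h2, h3⟩
    · simp [δ, ψ, h1, h2]
    · have h4 : RightIdem (a (W i)) e ↔ F i = e :=
        ⟨fun h => h2.unique hb h, fun h => h ▸ h2⟩
      have h5 : LeftIdem (a (W i)) e ↔ F (i + 1) = e :=
        ⟨fun h => h3.unique hb h, fun h => h ▸ h3⟩
      simp only [δ, ψ, h1, h4, h5, if_false]
  have hsum : δ 0 - δ (M * N) = M * ∑ t ∈ Finset.range N, ψ t := by
    rw [← nsmul_eq_mul, ← hW.sum_eq, ← Finset.sum_range_sub']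
    exact Finset.sum_congr rfl fun i hi => hstep i (Finset.mem_range.1 hi)
  have hdvd : (M : ℤ) ∣ δ 0 - δ (M * N) := ⟨_, hsum⟩
  by_cases hne : F (M * N) = e
  · rwa [hne] at hFn
  · simp only [δ, hF0, hne, if_true, if_false, sub_zero] at hdvd
    have := Int.le_of_dvd one_pos hdvd
    omega

/-- The member of the unit group of a local monoid given by an element whose left and right
idempotents agree. -/
theorem exists_unit_of_idem {e x : Mo} (he : e * e = e) (hR : RightIdem x e) (hL : LeftIdem x e) :
    letI := localMonoid he
    ∃ g : (LocalMonoid e)ˣ, g.1.1 = x := by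
  let := localMonoid he
  obtain ⟨-, hex, y, hy⟩ := hR
  obtain ⟨-, hxe, z, hz⟩ := hL
  have h1 : x * (e * y * e) = e := by
    calc x * (e * y * e) = x * e * y * e := by simp only [mul_assoc]
      _ = e := by rw [hxe, hy, he]
  have h2 : e * y * e * x = e := by
    calc e * y * e * x = z * (x * y) * (e * x) := by rw [← hz]; simp only [mul_assoc]
      _ = e := by rw [hy, hex, mul_assoc, hex, hz]
  exact ⟨⟨⟨x, hex, hxe⟩, ⟨e * y * e, by simp only [← mul_assoc, he], by rw [mul_assoc, he]⟩,
    Subtype.ext h1, Subtype.ext h2⟩, rfl⟩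

theorem IsBlockGroup.blockWord_letters [Finite Mo] (hb : IsBlockGroup Mo) (hM : 2 ≤ M)
    (hcard : Nat.card Mo ≤ M) (hid : ∀ x : Mo, x ^ M * x ^ M = x ^ M) (hW : IsBlockWord W M N)
    {E : Set Mo}
    (hE : ∀ x ∈ E, ∃ a : ℕ → Mo, (∀ t, a t ∈ E) ∧ x = seqProd (fun i => a (W i)) (M * N))
    {v : Mo} (hvE : v ∈ E) (hv : v * v ≠ v)
    (htop : ∀ a ∈ E, a * a ≠ a → (∃ u w, u * a * w = v) → ∃ u w, u * v * w = a) :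
    ∃ e, ∃ a : ℕ → Mo, RightIdem v e ∧ LeftIdem v e ∧ (∀ t, a t ∈ E) ∧
      v = seqProd (fun i => a (W i)) (M * N) ∧
      ∀ t < N, e * a t = e ∨ (RightIdem (a t) e ∧ LeftIdem (a t) e) := by
  have hdiv : ∀ {a : ℕ → Mo} {x : Mo}, x = seqProd (fun i => a (W i)) (M * N) → ∀ t < N,
      ∃ u w, u * a t * w = x := by
    intro a x hx t ht
    obtain ⟨s, hs, hst⟩ := hW.exists_index (j := 0) (t := t) (by omega) ht
    have hNn : 1 * N ≤ M * N := Nat.mul_le_mul_right N (by omega)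
    have hle : 0 * N + s + 1 ≤ M * N := by omega
    obtain ⟨d, hd⟩ := Nat.exists_eq_add_of_le hle
    exact ⟨seqProd (fun i => a (W i)) (0 * N + s), seqProd (fun i => a (W (0 * N + s + 1 + i))) d,
      by rw [hx, hd, seqProd_add _ (0 * N + s + 1) d, seqProd_succ, hst]⟩
  have hpath : ∀ x ∈ E, x * x ≠ x →
      (∀ a ∈ E, a * a ≠ a → (∃ u w, u * a * w = x) → ∃ u w, u * x * w = a) →
      ∃ a : ℕ → Mo, (∀ t, a t ∈ E) ∧ x = seqProd (fun i => a (W i)) (M * N) ∧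
      ∃ (e : Mo) (F : ℕ → Mo), RightIdem x e ∧ F 0 = e ∧ LeftIdem x e ∧
      ∀ i < M * N, (a (W i) * a (W i) = a (W i) ∧ F (i + 1) = F i ∧ F i * a (W i) = F i) ∨
        (a (W i) * a (W i) ≠ a (W i) ∧ RightIdem (a (W i)) (F i) ∧
          LeftIdem (a (W i)) (F (i + 1))) := by
    intro x hxE hx hxtop
    obtain ⟨a, haE, hxa⟩ := hE x hxE
    obtain ⟨e, F, h1, h2, h3, h4⟩ := hb.exists_path hM hid hW hxa
      (fun t ht hta => hxtop _ (haE t) hta (hdiv hxa t ht)) (by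
        by_contra hcon
        push Not at hcon
        exact hx (by rw [hxa]; exact hb.seqProd_idem (by omega) hcard hid hW hcon))
    exact ⟨a, haE, hxa, e, F, h1, h2, hb.leftIdem_of_path hM hW h2 h3 h4, h4⟩
  obtain ⟨a, haE, hva, e, F, hRe, hF0, hLe, hF⟩ := hpath v hvE hv htop
  have hgrp : ∀ t < N, a t * a t ≠ a t → ∃ f, RightIdem (a t) f ∧ LeftIdem (a t) f := by
    intro t ht hta
    obtain ⟨u, w, huw⟩ := hdiv hva t ht
    obtain ⟨u', w', huw'⟩ := htop _ (haE t) hta ⟨u, w, huw⟩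
    obtain ⟨_, _, _, f, _, h1, _, h2, _⟩ := hpath (a t) (haE t) hta (by
      rintro b hbE hbb ⟨p, q, hpq⟩
      obtain ⟨p', q', hpq'⟩ := htop b hbE hbb ⟨u * p, q * w, by
        rw [← huw, ← hpq]; simp only [mul_assoc]⟩
      exact ⟨p' * u, w * q', by rw [← hpq', ← huw]; simp only [mul_assoc]⟩)
    exact ⟨f, h1, h2⟩
  have hconst : ∀ i ≤ M * N, F i = e := by
    intro i
    induction i with
    | zero => exact fun _ => hF0
    | succ i ih =>
      intro hi
      rcases hF i hi with ⟨-, h, -⟩ | ⟨h1, h2, h3⟩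
      · rw [h, ih (by omega)]
      · obtain ⟨f, h4, h5⟩ := hgrp _ (hW.lt hi) h1
        rw [h3.unique hb h5, h4.unique hb h2, ih (by omega)]
  refine ⟨e, a, hRe, hLe, haE, hva, fun t ht => ?_⟩
  obtain ⟨s, hs, hst⟩ := hW.exists_index (j := 0) (t := t) (by omega) ht
  have hNn : 1 * N ≤ M * N := Nat.mul_le_mul_right N (by omega)
  have hlt : 0 * N + s < M * N := by omega
  have h := hF _ hlt
  rw [hconst _ hlt.le, hconst _ hlt, hst] at h
  rcases h with ⟨-, -, h⟩ | ⟨-, h⟩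
  · exact Or.inl h
  · exact Or.inr h

/-- A set of values of a block word with letters in the set consists of idempotents, provided
that the monoid is a block-group with solvable subgroups and that there are enough blocks. -/
theorem IsBlockGroup.blockWord_values_idem [Finite Mo] (hb : IsBlockGroup Mo)
    (hsolv : ∀ (G : Type u) [Group G] (f : G →ₙ* Mo), Function.Injective f → Group.IsSolvable G)
    (hM : 2 ≤ M) (hcard : Nat.card Mo ≤ M) (hid : ∀ x : Mo, x ^ M * x ^ M = x ^ M)
    (hW : IsBlockWord W M N) {E : Set Mo}
    (hE : ∀ x ∈ E, ∃ a : ℕ → Mo, (∀ t, a t ∈ E) ∧ x = seqProd (fun i => a (W i)) (M * N)) :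
    ∀ x ∈ E, x * x = x := by
  classical
  by_contra hcon
  push Not at hcon
  obtain ⟨x₀, hx₀⟩ := hcon
  obtain ⟨v, ⟨hvE, hvv⟩, hmin⟩ := Set.exists_min_image {x | x ∈ E ∧ x * x ≠ x}
    (fun x => {y | ∃ u w, u * y * w = x}.ncard) (Set.toFinite _) ⟨x₀, hx₀⟩
  have htop : ∀ a ∈ E, a * a ≠ a → (∃ u w, u * a * w = v) → ∃ u w, u * v * w = a := by
    rintro a haE haa ⟨u, w, huw⟩
    have hsub : {y | ∃ u w, u * y * w = a} ⊆ {y | ∃ u w, u * y * w = v} := by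
      rintro y ⟨p, q, hpq⟩
      exact ⟨u * p, q * w, by rw [← huw, ← hpq]; simp only [mul_assoc]⟩
    have heq := Set.eq_of_subset_of_ncard_le hsub (hmin a ⟨haE, haa⟩) (Set.toFinite _)
    have : v ∈ {y | ∃ u w, u * y * w = v} := ⟨1, 1, by simp⟩
    rwa [← heq] at this
  obtain ⟨e, -, hRe, hLe, -⟩ := hb.blockWord_letters hM hcard hid hW hE hvE hvv htop
  have he := hRe.1
  let := localMonoid he
  let G := (LocalMonoid e)ˣ
  let ι : G →ₙ* Mo := ⟨fun g => g.1.1, fun _ _ => rfl⟩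
  have hι : Function.Injective ι := fun g g' h => Units.ext (Subtype.ext h)
  have hG : Group.IsSolvable G := hsolv G ι hι
  have hι1 : ι 1 = e := rfl
  have hιe : ∀ g, ι g * e = ι g := fun g => g.1.2.2
  have heι : ∀ g, e * ι g = ι g := fun g => g.1.2.1
  have hpow : ∀ (g : G) (m : ℕ), ι (g ^ (m + 1)) = ι g ^ (m + 1) := by
    intro g m
    induction m with
    | zero => simp
    | succ m ih => rw [pow_succ, map_mul, ih, pow_succ _ (m + 1)]
  have hexp : ∀ g : G, g ^ M = 1 := by
    intro g
    obtain ⟨m, rfl⟩ := Nat.exists_eq_succ_of_ne_zero (by omega : M ≠ 0)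
    have : g ^ (m + 1) * g ^ (m + 1) = g ^ (m + 1) := hι (by rw [map_mul, hpow, hid])
    simpa using this
  obtain ⟨gv, hgv⟩ := exists_unit_of_idem he hRe hLe
  have hone := eq_one_of_mem_blockWord_values hW hexp (F := {g : G | ι g ∈ E} ∪ {1}) (by
    intro g hg
    by_cases hg1 : g = 1
    · refine ⟨fun _ => 1, fun _ => by simp, ?_⟩
      rw [hg1]
      have := mul_seqProd_of_fixed (s := (1 : G)) (g := fun _ => 1) (M * N) (by simp)
      simpa using this.symm
    have hgE : ι g ∈ E := by simpa [hg1] using hg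
    have hgg : ι g * ι g ≠ ι g := by
      rw [← map_mul]
      intro h
      exact hg1 (by simpa using hι h)
    have hRg : RightIdem (ι g) e := ⟨he, heι g, ι g⁻¹, by rw [← map_mul, mul_inv_cancel, hι1]⟩
    obtain ⟨e', a, hRe', -, haE, hga, ha⟩ := hb.blockWord_letters hM hcard hid hW hE hgE hgg (by
      rintro a haE haa ⟨p, q, hpq⟩
      obtain ⟨p', q', hpq'⟩ := htop a haE haa ⟨p, q * ι (g⁻¹ * gv), by
        calc p * a * (q * ι (g⁻¹ * gv)) = p * a * q * ι (g⁻¹ * gv) := by simp only [mul_assoc]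
          _ = v := by rw [hpq, ← map_mul, mul_inv_cancel_left]; exact hgv⟩
      refine ⟨p', ι (g⁻¹ * gv) * q', ?_⟩
      rw [← hpq', ← hgv]
      calc p' * ι g * (ι (g⁻¹ * gv) * q') = p' * ι (g * (g⁻¹ * gv)) * q' := by
            rw [map_mul ι g]; simp only [mul_assoc]
        _ = _ := by rw [mul_inv_cancel_left]; rfl)
    obtain rfl := hRe'.unique hb hRg
    have hex : ∀ t, ∃ b : G, (ι b ∈ E ∨ b = 1) ∧ (t < N → e' * a t = ι b) := by
      intro t
      by_cases ht : t < N
      · rcases ha t ht with h | ⟨h1, h2⟩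
        · exact ⟨1, Or.inr rfl, fun _ => by rw [h, hι1]⟩
        · obtain ⟨b, hb'⟩ := exists_unit_of_idem he h1 h2
          have hb' : ι b = a t := hb'
          exact ⟨b, Or.inl (by rw [hb']; exact haE t), fun _ => by rw [hb', h1.2.1]⟩
      · exact ⟨1, Or.inr rfl, fun h => absurd h ht⟩
    choose b hbF hba using hex
    refine ⟨b, fun t => by simpa [or_comm] using hbF t, hι ?_⟩
    have key : ∀ i ≤ M * N, e' * seqProd (fun i => a (W i)) i = ι (seqProd (fun i => b (W i)) i) := by
      intro i
      induction i with
      | zero => intro; simp [hι1]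
      | succ i ih =>
        intro hi
        rw [seqProd_succ, seqProd_succ, map_mul, ← hba _ (hW.lt hi), ← mul_assoc, ih (by omega),
          ← mul_assoc, hιe]
    rw [← key _ le_rfl, ← hga, heι])
  have hgv1 : gv = 1 := hone gv (Or.inl (by change gv.1.1 ∈ E; rw [hgv]; exact hvE))
  apply hvv
  rw [← hgv, hgv1]
  exact he

end Values

/-! ### Block words in which close letters are scattered -/

/-- Among the first `n` positions of `W`, equal letters are more than `k` apart, and two different
letters come within distance `k` of each other at most once. -/
structure IsScattered (W : ℕ → ℕ) (n k : ℕ) : Prop where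
  eq_of_near : ∀ {i j}, i < n → j < n → W i = W j → i ≤ j + k → j ≤ i + k → i = j
  eq_of_pair : ∀ {i i' u u'}, i < n → i' < n → u < n → u' < n → W i = W u → W i' = W u' →
    i ≠ i' → i ≤ i' + k → i' ≤ i + k → u ≤ u' + k → u' ≤ u + k → i = u

/-- The sequence running through the residues modulo `N` in blocks, with step `B ^ j` in the block
number `j`. -/
def stepWord (B N : ℕ) (i : ℕ) : ℕ := B ^ (i / N) * (i % N) % N

section StepWord

variable {B N M k : ℕ}

theorem stepWord_eq_of_mod (hBN : Nat.Coprime B N) {i u : ℕ} (hN : 0 < N)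
    (h : stepWord B N i = stepWord B N u) (hblock : i / N = u / N) : i = u := by
  unfold stepWord at h
  rw [hblock] at h
  have h1 : i % N ≡ u % N [MOD N] :=
    Nat.ModEq.cancel_left_of_coprime (hBN.pow_left (u / N)).symm h
  have h2 : i % N = u % N := h1.eq_of_lt_of_lt (Nat.mod_lt _ hN) (Nat.mod_lt _ hN)
  rw [← Nat.div_add_mod i N, ← Nat.div_add_mod u N, hblock, h2]

theorem stepWord_isBlockWord (hBN : Nat.Coprime B N) : IsBlockWord (stepWord B N) M N := by
  intro j _
  rcases Nat.eq_zero_or_pos N with rfl | hN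
  · simp [Set.BijOn, Set.MapsTo, Set.InjOn, Set.SurjOn]
  have hmaps : Set.MapsTo (fun s => stepWord B N (j * N + s)) (Set.Iio N) (Set.Iio N) :=
    fun s _ => Nat.mod_lt _ hN
  refine (Set.Finite.injOn_iff_bijOn_of_mapsTo (Set.finite_Iio N) hmaps).1 ?_
  intro s hs s' hs' h
  have hdiv : ∀ s ∈ Set.Iio N, (j * N + s) / N = j := fun s hs => by
    rw [mul_comm, Nat.mul_add_div hN, Nat.div_eq_of_lt hs, add_zero]
  have := stepWord_eq_of_mod hBN hN h (by rw [hdiv s hs, hdiv s' hs'])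
  omega

theorem stepWord_diff (hkN : k < N) {i i' : ℕ} (hii : i < i') (hik : i' ≤ i + k) :
    ∃ a b, 0 < a ∧ a + b ≤ k ∧
      stepWord B N i + (B ^ (i / N) * a + B ^ (i / N + 1) * b) ≡ stepWord B N i' [MOD N] := by
  have hN : 0 < N := by omega
  have hi := Nat.div_add_mod' i N
  have hi' := Nat.div_add_mod' i' N
  have hm := Nat.mod_lt i hN
  have hm' := Nat.mod_lt i' hN
  set j := i / N with hj
  have h1 : j ≤ i' / N := Nat.div_le_div_right hii.le
  have h2 : i' / N < j + 2 := by
    rw [Nat.div_lt_iff_lt_mul hN, Nat.add_mul]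
    omega
  have hmod : ∀ x, stepWord B N x ≡ B ^ (x / N) * (x % N) [MOD N] := fun x => Nat.mod_modEq _ _
  obtain h | h : i' / N = j ∨ i' / N = j + 1 := by omega
  · refine ⟨i' - i, 0, by omega, by omega, ?_⟩
    rw [h] at hi'
    have h3 : i' % N = i % N + (i' - i) := by omega
    refine ((hmod i).add_right _).trans (Nat.ModEq.trans ?_ (hmod i').symm)
    rw [h, h3, ← hj, mul_zero, add_zero, mul_add]
  · refine ⟨N - i % N, i' % N, by omega, ?_, ?_⟩
    · rw [h, Nat.succ_mul] at hi'
      omega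
    · refine ((hmod i).add_right _).trans (Nat.ModEq.trans ?_ (hmod i').symm)
      rw [h, ← hj, ← add_assoc, ← mul_add, Nat.add_sub_cancel' hm.le]
      simp

theorem stepWord_isScattered (hBN : Nat.Coprime B N) (hkB : k < B) (hN : 2 * (k * B ^ M) < N) :
    IsScattered (stepWord B N) (M * N) k := by
  have hB : 0 < B := by omega
  have hBM : 0 < B ^ M := pow_pos hB M
  have hkN : k < N := by nlinarith
  have hN0 : 0 < N := by omega
  have hbound : ∀ {i a b}, i < M * N → a + b ≤ k →
      2 * (B ^ (i / N) * a + B ^ (i / N + 1) * b) < N := by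
    intro i a b hi hab
    have h1 : i / N < M := by rwa [Nat.div_lt_iff_lt_mul hN0]
    have h2 : B ^ (i / N) ≤ B ^ M := Nat.pow_le_pow_right hB h1.le
    have h3 : B ^ (i / N + 1) ≤ B ^ M := Nat.pow_le_pow_right hB h1
    have h4 : B ^ (i / N) * a + B ^ (i / N + 1) * b ≤ B ^ M * (a + b) := by
      rw [mul_add]; gcongr
    have h5 : B ^ M * (a + b) ≤ k * B ^ M := by rw [mul_comm]; gcongr
    omega
  have hpos : ∀ {i a : ℕ} (b : ℕ), 0 < a → 0 < B ^ (i / N) * a + B ^ (i / N + 1) * b := by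
    intro i a b ha
    have := Nat.mul_pos (pow_pos hB (i / N)) ha
    omega
  have hnear : ∀ {i j}, i < M * N → stepWord B N i = stepWord B N j → i < j → j ≤ i + k →
      False := by
    intro i j hi h hij hjk
    obtain ⟨a, b, ha, hab, hmod⟩ := stepWord_diff (B := B) hkN hij hjk
    rw [← h] at hmod
    have h1 := Nat.ModEq.add_left_cancel' (stepWord B N i) (b := 0) (by simpa using hmod)
    have h2 := Nat.le_of_dvd (hpos b ha) (Nat.modEq_zero_iff_dvd.1 h1)
    have h3 := hbound hi hab
    omega
  have heq : ∀ {i j}, i < M * N → j < M * N → stepWord B N i = stepWord B N j → i ≤ j + k →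
      j ≤ i + k → i = j := by
    intro i j hi hj h h1 h2
    rcases lt_trichotomy i j with h3 | h3 | h3
    · exact (hnear hi h h3 h2).elim
    · exact h3
    · exact (hnear hj h.symm h3 h1).elim
  have hpair : ∀ {i i' u u'}, i < M * N → u < M * N → stepWord B N i = stepWord B N u →
      stepWord B N i' = stepWord B N u' → i < i' → i' ≤ i + k → u < u' → u' ≤ u + k → i = u := by
    intro i i' u u' hi hu h h' h1 h2 h3 h4
    obtain ⟨a, b, ha, hab, hmod⟩ := stepWord_diff (B := B) hkN h1 h2
    obtain ⟨c, d, hc, hcd, hmod'⟩ := stepWord_diff (B := B) hkN h3 h4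
    rw [← h, ← h'] at hmod'
    have h5 := (Nat.ModEq.add_left_cancel' _ (hmod.trans hmod'.symm)).eq_of_lt_of_lt
      (by have := hbound hi hab; omega) (by have := hbound hu hcd; omega)
    refine stepWord_eq_of_mod hBN hN0 h ?_
    have hdig : ∀ {j l a b c d : ℕ}, 0 < a → a ≤ k → j < l →
        B ^ j * a + B ^ (j + 1) * b = B ^ l * c + B ^ (l + 1) * d → False := by
      intro j l a b c d ha hak hjl he
      obtain ⟨r, rfl⟩ := Nat.exists_eq_add_of_lt hjl
      have h6 : a + B * b = B * (B ^ r * (c + B * d)) :=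
        Nat.eq_of_mul_eq_mul_left (pow_pos hB j) (by rw [pow_succ] at he; linear_combination he)
      have h7 : B ∣ a := (Nat.dvd_add_left (Dvd.intro _ rfl)).1 (h6 ▸ Dvd.intro _ rfl)
      have := Nat.le_of_dvd ha h7
      omega
    rcases lt_trichotomy (i / N) (u / N) with h6 | h6 | h6
    · exact (hdig ha (by omega) h6 h5).elim
    · exact h6
    · exact (hdig hc (by omega) h6 h5.symm).elim
  have hopp : ∀ {i i' u u'}, i < M * N → u' < M * N → stepWord B N i = stepWord B N u →
      stepWord B N i' = stepWord B N u' → i < i' → i' ≤ i + k → u' < u → u ≤ u' + k → False := by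
    intro i i' u u' hi hu h h' h1 h2 h3 h4
    obtain ⟨a, b, ha, hab, hmod⟩ := stepWord_diff (B := B) hkN h1 h2
    obtain ⟨c, d, hc, hcd, hmod'⟩ := stepWord_diff (B := B) hkN h3 h4
    rw [← h, ← h'] at hmod'
    have h5 := (hmod.add_right _).trans hmod'
    rw [add_assoc] at h5
    have h6 := Nat.ModEq.add_left_cancel' (stepWord B N i) (b := 0) (by simpa using h5)
    have h7 := Nat.le_of_dvd (by have := hpos (i := i) b ha; omega) (Nat.modEq_zero_iff_dvd.1 h6)
    have h8 := hbound hi hab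
    have h9 := hbound hu hcd
    omega
  refine ⟨heq, ?_⟩
  intro i i' u u' hi hi' hu hu' h h' hne h1 h2 h3 h4
  rcases lt_or_gt_of_ne hne with h5 | h5
  · rcases lt_trichotomy u u' with h6 | h6 | h6
    · exact hpair hi hu h h' h5 h2 h6 h4
    · subst h6
      exact (hnear hi (h.trans h'.symm) h5 h2).elim
    · exact (hopp hi hu' h h' h5 h2 h6 h3).elim
  · rcases lt_trichotomy u u' with h6 | h6 | h6
    · exact (hopp hu hi' h.symm h'.symm h6 h4 h5 h1).elim
    · subst h6
      exact (hnear hi' (h'.trans h.symm) h5 h1).elim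
    · obtain rfl := hpair hi' hu' h' h h5 h1 h6 h3
      exact heq hi hu h (by omega) (by omega)

/-- There are scattered block words with arbitrarily many blocks. -/
theorem exists_scattered_blockWord (M k : ℕ) :
    ∃ (W : ℕ → ℕ) (N : ℕ), 0 < N ∧ IsBlockWord W M N ∧ IsScattered W (M * N) k := by
  have hcop : Nat.Coprime (k + 1) (2 * k * (k + 1) ^ (M + 1) + 1) := by
    rw [pow_succ, ← mul_assoc]
    simp
  refine ⟨stepWord (k + 1) (2 * k * (k + 1) ^ (M + 1) + 1), 2 * k * (k + 1) ^ (M + 1) + 1,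
    Nat.succ_pos _, stepWord_isBlockWord hcop, stepWord_isScattered hcop (by omega) ?_⟩
  have : (k + 1) ^ M ≤ (k + 1) ^ (M + 1) := Nat.pow_le_pow_right (by omega) (by omega)
  nlinarith

end StepWord

/-! ### Systems of partial injections that are locally separated by two-colourings -/

/-- Composition of binary relations on `ℕ`. -/
def relComp (a b : Set (ℕ × ℕ)) : Set (ℕ × ℕ) := {p | ∃ z, (p.1, z) ∈ a ∧ (z, p.2) ∈ b}

/-- The binary relation `a` is a partial injection. -/
def IsPartialInj (a : Set (ℕ × ℕ)) : Prop :=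
  (∀ {x y y'}, (x, y) ∈ a → (x, y') ∈ a → y = y') ∧ (∀ {x w y}, (x, y) ∈ a → (w, y) ∈ a → x = w)

/-- The ends of each pair in `a` have the same colour. -/
def IsFlat (c : ℕ → Bool) (a : Set (ℕ × ℕ)) : Prop := ∀ p ∈ a, c p.1 = c p.2

/-- All pairs in `a` are coloured in the same way. -/
def IsUniform (c : ℕ → Bool) (a : Set (ℕ × ℕ)) : Prop :=
  ∀ p ∈ a, ∀ q ∈ a, c p.1 = c q.1 ∧ c p.2 = c q.2

/-- All members of `K` are flat or uniform under the colouring `c`. -/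
def IsAdmissible (c : ℕ → Bool) (K : Finset (Set (ℕ × ℕ))) : Prop :=
  ∀ a ∈ K, IsFlat c a ∨ IsUniform c a

/-- `T` is a set of partial injections of `{0, …, L}` closed under intersection and composition
such that for any at most `k` of its members, points and domains are separated by admissible
colourings. -/
structure IsSeparated (L : ℕ) (T : Set (Set (ℕ × ℕ))) (k : ℕ) : Prop where
  pos : 0 < L
  bdd : ∀ {a}, a ∈ T → ∀ {x y}, (x, y) ∈ a → x ≤ L ∧ y ≤ L
  inj : ∀ {a}, a ∈ T → IsPartialInj a
  inter : ∀ {a b}, a ∈ T → b ∈ T → a ∩ b ∈ T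
  comp : ∀ {a b}, a ∈ T → b ∈ T → relComp a b ∈ T
  points : ∀ {K : Finset (Set (ℕ × ℕ))}, (∀ a ∈ K, a ∈ T) → K.card ≤ k →
    ∀ {j j'}, j ≤ L → j' ≤ L → j ≠ j' → ∃ c, IsAdmissible c K ∧ c j ≠ c j'
  dom : ∀ {K : Finset (Set (ℕ × ℕ))}, (∀ a ∈ K, a ∈ T) → K.card ≤ k →
    ∀ a ∈ K, ∀ l ≤ L, (∀ y, (l, y) ∉ a) →
      ∃ c, IsAdmissible c K ∧ IsUniform c a ∧ ∀ p ∈ a, c p.1 ≠ c l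

/-- The subsingleton relations on `{0, …, L}`. -/
def smallRels (L : ℕ) : Set (Set (ℕ × ℕ)) :=
  {a | a.Subsingleton ∧ ∀ x y, (x, y) ∈ a → x ≤ L ∧ y ≤ L}

/-- The union of the copies of `a` shifted to the segments `[i * L, (i + 1) * L]` with `W i = t`. -/
def liftRel (W : ℕ → ℕ) (n L t : ℕ) (a : Set (ℕ × ℕ)) : Set (ℕ × ℕ) :=
  {p | ∃ i x y, i < n ∧ W i = t ∧ (x, y) ∈ a ∧ p = (i * L + x, i * L + y)}

/-- The subsingleton relations on `{0, …, n * L}` and the lifted members of `T`. -/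
def extendRels (W : ℕ → ℕ) (n L : ℕ) (T : Set (Set (ℕ × ℕ))) : Set (Set (ℕ × ℕ)) :=
  smallRels (n * L) ∪ {b | ∃ t, ∃ a ∈ T, b = liftRel W n L t a}

theorem isUniform_of_subsingleton (c : ℕ → Bool) {a : Set (ℕ × ℕ)} (h : a.Subsingleton) :
    IsUniform c a := fun p hp q hq => by rw [h hp hq]; exact ⟨rfl, rfl⟩

theorem isPartialInj_of_subsingleton {a : Set (ℕ × ℕ)} (h : a.Subsingleton) : IsPartialInj a :=
  ⟨fun h1 h2 => (Prod.ext_iff.1 (h h1 h2)).2, fun h1 h2 => (Prod.ext_iff.1 (h h1 h2)).1⟩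

theorem subsingleton_relComp_left {a b : Set (ℕ × ℕ)} (ha : a.Subsingleton) (hb : IsPartialInj b) :
    (relComp a b).Subsingleton := by
  rintro ⟨x, y⟩ ⟨z, h1, h2⟩ ⟨x', y'⟩ ⟨z', h1', h2'⟩
  obtain ⟨rfl, rfl⟩ := Prod.ext_iff.1 (ha h1 h1')
  exact Prod.ext rfl (hb.1 h2 h2')

theorem subsingleton_relComp_right {a b : Set (ℕ × ℕ)} (ha : IsPartialInj a)
    (hb : b.Subsingleton) : (relComp a b).Subsingleton := by
  rintro ⟨x, y⟩ ⟨z, h1, h2⟩ ⟨x', y'⟩ ⟨z', h1', h2'⟩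
  obtain ⟨rfl, rfl⟩ := Prod.ext_iff.1 (hb h2 h2')
  exact Prod.ext (ha.2 h1 h1') rfl

theorem smallRels_isSeparated {L : ℕ} (hL : 0 < L) (k : ℕ) : IsSeparated L (smallRels L) k where
  pos := hL
  bdd ha := ha.2 _ _
  inj ha := isPartialInj_of_subsingleton ha.1
  inter ha _ := ⟨ha.1.anti Set.inter_subset_left, fun x y h => ha.2 x y h.1⟩
  comp ha hb := ⟨subsingleton_relComp_left ha.1 (isPartialInj_of_subsingleton hb.1),
    fun x y ⟨z, h1, h2⟩ => ⟨(ha.2 _ _ h1).1, (hb.2 _ _ h2).2⟩⟩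
  points hK _ j j' _ _ hne := ⟨fun x => decide (x = j),
    fun a ha => Or.inr (isUniform_of_subsingleton _ (hK a ha).1), by simp [hne.symm]⟩
  dom hK _ a ha l _ hla := ⟨fun x => decide (x = l),
    fun a ha => Or.inr (isUniform_of_subsingleton _ (hK a ha).1),
    isUniform_of_subsingleton _ (hK a ha).1, fun p hp => by
      have : p.1 ≠ l := fun h => hla p.2 (h ▸ hp)
      simpa using this⟩

theorem segment_cases {L i i' x x' : ℕ} (hL : 0 < L) (hx : x ≤ L) (hx' : x' ≤ L)
    (h : i * L + x = i' * L + x') (hne : i < i') : i' = i + 1 ∧ i * L + x = i' * L := by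
  obtain ⟨d, rfl⟩ := Nat.exists_eq_add_of_lt hne
  have h1 : (i + d + 1) * L = i * L + d * L + L := by ring
  have h3 : d * L = 0 := by omega
  rcases Nat.mul_eq_zero.1 h3 with rfl | rfl
  · exact ⟨rfl, by omega⟩
  · omega

section Lift

variable {W : ℕ → ℕ} {n k L : ℕ}

theorem IsScattered.segment_unique (hW : IsScattered W n k) (hk : 1 ≤ k) (hL : 0 < L)
    {i i' x x' : ℕ} (hi : i < n) (hi' : i' < n) (hx : x ≤ L) (hx' : x' ≤ L) (hii : W i = W i')
    (h : i * L + x = i' * L + x') : i = i' ∧ x = x' := by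
  have : i = i' := by
    rcases lt_trichotomy i i' with h1 | h1 | h1
    · obtain ⟨h2, -⟩ := segment_cases hL hx hx' h h1
      exact hW.eq_of_near hi hi' hii (by omega) (by omega)
    · exact h1
    · obtain ⟨h2, -⟩ := segment_cases hL hx' hx h.symm h1
      exact hW.eq_of_near hi hi' hii (by omega) (by omega)
  subst this
  exact ⟨rfl, by omega⟩

theorem IsScattered.meet_unique (hW : IsScattered W n k) (hk : 1 ≤ k) (hL : 0 < L)
    {i i' u u' x x' z z' : ℕ} (hi : i < n) (hi' : i' < n) (hu : u < n) (hu' : u' < n)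
    (hx : x ≤ L) (hx' : x' ≤ L) (hz : z ≤ L) (hz' : z' ≤ L) (hiu : W i = W u) (hiu' : W i' = W u')
    (hne : W i ≠ W i') (h : i * L + x = i' * L + x') (h' : u * L + z = u' * L + z') :
    i * L + x = u * L + z := by
  have key : ∀ {i i' x x'}, x ≤ L → x' ≤ L → W i ≠ W i' → i * L + x = i' * L + x' →
      i ≠ i' ∧ i ≤ i' + k ∧ i' ≤ i + k ∧ i * L + x = max i i' * L := by
    intro i i' x x' hx hx' hne h
    rcases lt_trichotomy i i' with h1 | h1 | h1
    · obtain ⟨h2, h3⟩ := segment_cases hL hx hx' h h1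
      rw [max_eq_right h1.le]
      exact ⟨h1.ne, by omega, by omega, h3⟩
    · exact absurd (h1 ▸ rfl) hne
    · obtain ⟨h2, h3⟩ := segment_cases hL hx' hx h.symm h1
      rw [max_eq_left h1.le]
      exact ⟨h1.ne', by omega, by omega, h.trans h3⟩
  obtain ⟨h1, h2, h3, h4⟩ := key hx hx' hne h
  obtain ⟨h5, h6, h7, h8⟩ := key hz hz' (hiu ▸ hiu' ▸ hne) h'
  have h9 := hW.eq_of_pair hi hi' hu hu' hiu hiu' h1 h2 h3 h6 h7
  have h10 := hW.eq_of_pair hi' hi hu' hu hiu' hiu h1.symm h3 h2 h7 h6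
  rw [h4, h8, h9, h10]

theorem liftRel_bdd {T : Set (Set (ℕ × ℕ))} (hT : IsSeparated L T k) {a : Set (ℕ × ℕ)} (ha : a ∈ T)
    {t x y : ℕ} (h : (x, y) ∈ liftRel W n L t a) : x ≤ n * L ∧ y ≤ n * L := by
  obtain ⟨i, x', y', hi, -, hxy, heq⟩ := h
  obtain ⟨rfl, rfl⟩ := Prod.ext_iff.1 heq
  have h1 := hT.bdd ha hxy
  have h2 : (i + 1) * L ≤ n * L := Nat.mul_le_mul_right L hi
  rw [Nat.succ_mul] at h2
  constructor <;> dsimp only <;> omega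

variable {T : Set (Set (ℕ × ℕ))}

theorem liftRel_inj (hW : IsScattered W n k) (hk : 1 ≤ k) (hT : IsSeparated L T k)
    {a : Set (ℕ × ℕ)} (ha : a ∈ T) (t : ℕ) : IsPartialInj (liftRel W n L t a) := by
  constructor
  · rintro x y y' ⟨i, p, q, hi, hit, hpq, heq⟩ ⟨i', p', q', hi', hit', hpq', heq'⟩
    obtain ⟨rfl, rfl⟩ := Prod.ext_iff.1 heq
    obtain ⟨h1, rfl⟩ := Prod.ext_iff.1 heq'
    obtain ⟨rfl, rfl⟩ := hW.segment_unique hk hT.pos hi hi' (hT.bdd ha hpq).1 (hT.bdd ha hpq').1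
      (hit.trans hit'.symm) h1
    dsimp only
    rw [(hT.inj ha).1 hpq hpq']
  · rintro x x' y ⟨i, p, q, hi, hit, hpq, heq⟩ ⟨i', p', q', hi', hit', hpq', heq'⟩
    obtain ⟨rfl, rfl⟩ := Prod.ext_iff.1 heq
    obtain ⟨rfl, h1⟩ := Prod.ext_iff.1 heq'
    obtain ⟨rfl, rfl⟩ := hW.segment_unique hk hT.pos hi hi' (hT.bdd ha hpq).2 (hT.bdd ha hpq').2
      (hit.trans hit'.symm) h1
    dsimp only
    rw [(hT.inj ha).2 hpq hpq']

theorem extendRels_bdd (hT : IsSeparated L T k) {a : Set (ℕ × ℕ)} (ha : a ∈ extendRels W n L T)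
    {x y : ℕ} (h : (x, y) ∈ a) : x ≤ n * L ∧ y ≤ n * L := by
  rcases ha with ha | ⟨t, b, hb, rfl⟩
  · exact ha.2 x y h
  · exact liftRel_bdd hT hb h

theorem extendRels_inj (hW : IsScattered W n k) (hk : 1 ≤ k) (hT : IsSeparated L T k)
    {a : Set (ℕ × ℕ)} (ha : a ∈ extendRels W n L T) : IsPartialInj a := by
  rcases ha with ha | ⟨t, b, hb, rfl⟩
  · exact isPartialInj_of_subsingleton ha.1
  · exact liftRel_inj hW hk hT hb t

theorem extendRels_inter (hW : IsScattered W n k) (hk : 1 ≤ k) (hT : IsSeparated L T k)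
    {a b : Set (ℕ × ℕ)} (ha : a ∈ extendRels W n L T) (hb : b ∈ extendRels W n L T) :
    a ∩ b ∈ extendRels W n L T := by
  have hbdd : ∀ x y, (x, y) ∈ a ∩ b → x ≤ n * L ∧ y ≤ n * L := fun x y h =>
    extendRels_bdd hT ha h.1
  rcases ha with ha | ⟨t, a, ha, rfl⟩
  · exact Or.inl ⟨ha.1.anti Set.inter_subset_left, hbdd⟩
  rcases hb with hb | ⟨s, b, hb, rfl⟩
  · exact Or.inl ⟨hb.1.anti Set.inter_subset_right, hbdd⟩
  by_cases hts : t = s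
  · subst hts
    refine Or.inr ⟨t, a ∩ b, hT.inter ha hb, Set.Subset.antisymm ?_ ?_⟩
    · rintro _ ⟨⟨i, p, q, hi, hit, hpq, rfl⟩, ⟨i', p', q', hi', hit', hpq', heq'⟩⟩
      obtain ⟨h1, h2⟩ := Prod.ext_iff.1 heq'
      obtain ⟨rfl, rfl⟩ := hW.segment_unique hk hT.pos hi hi' (hT.bdd ha hpq).1
        (hT.bdd hb hpq').1 (hit.trans hit'.symm) h1
      obtain rfl : q = q' := by simpa using h2
      exact ⟨i, p, q, hi, hit, ⟨hpq, hpq'⟩, rfl⟩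
    · rintro _ ⟨i, p, q, hi, hit, hpq, rfl⟩
      exact ⟨⟨i, p, q, hi, hit, hpq.1, rfl⟩, ⟨i, p, q, hi, hit, hpq.2, rfl⟩⟩
  · refine Or.inl ⟨?_, hbdd⟩
    rintro _ ⟨⟨i, p, q, hi, hit, hpq, rfl⟩, ⟨i', p', q', hi', hit', hpq', h1⟩⟩
      _ ⟨⟨u, r, v, hu, hut, hrv, rfl⟩, ⟨u', r', v', hu', hut', hrv', h2⟩⟩
    obtain ⟨h3, h4⟩ := Prod.ext_iff.1 h1
    obtain ⟨h5, h6⟩ := Prod.ext_iff.1 h2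
    have hne : W i ≠ W i' := by rw [hit, hit']; exact hts
    exact Prod.ext
      (hW.meet_unique hk hT.pos hi hi' hu hu' (hT.bdd ha hpq).1 (hT.bdd hb hpq').1
        (hT.bdd ha hrv).1 (hT.bdd hb hrv').1 (hit.trans hut.symm) (hit'.trans hut'.symm) hne h3 h5)
      (hW.meet_unique hk hT.pos hi hi' hu hu' (hT.bdd ha hpq).2 (hT.bdd hb hpq').2
        (hT.bdd ha hrv).2 (hT.bdd hb hrv').2 (hit.trans hut.symm) (hit'.trans hut'.symm) hne h4 h6)

theorem extendRels_comp (hW : IsScattered W n k) (hk : 1 ≤ k) (hT : IsSeparated L T k)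
    {a b : Set (ℕ × ℕ)} (ha : a ∈ extendRels W n L T) (hb : b ∈ extendRels W n L T) :
    relComp a b ∈ extendRels W n L T := by
  have hbdd : ∀ x y, (x, y) ∈ relComp a b → x ≤ n * L ∧ y ≤ n * L := fun x y ⟨z, h1, h2⟩ =>
    ⟨(extendRels_bdd hT ha h1).1, (extendRels_bdd hT hb h2).2⟩
  have hai := extendRels_inj hW hk hT ha
  have hbi := extendRels_inj hW hk hT hb
  rcases ha with ha | ⟨t, a, ha, rfl⟩
  · exact Or.inl ⟨subsingleton_relComp_left ha.1 hbi, hbdd⟩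
  rcases hb with hb | ⟨s, b, hb, rfl⟩
  · exact Or.inl ⟨subsingleton_relComp_right hai hb.1, hbdd⟩
  by_cases hts : t = s
  · subst hts
    refine Or.inr ⟨t, relComp a b, hT.comp ha hb, Set.Subset.antisymm ?_ ?_⟩
    · rintro ⟨x, y⟩ ⟨_, ⟨i, p, q, hi, hit, hpq, h1⟩, ⟨i', p', q', hi', hit', hpq', h2⟩⟩
      obtain ⟨rfl, rfl⟩ := Prod.ext_iff.1 h1
      obtain ⟨h3, rfl⟩ := Prod.ext_iff.1 h2
      obtain ⟨rfl, rfl⟩ := hW.segment_unique hk hT.pos hi hi' (hT.bdd ha hpq).2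
        (hT.bdd hb hpq').1 (hit.trans hit'.symm) h3
      exact ⟨i, p, q', hi, hit, ⟨q, hpq, hpq'⟩, rfl⟩
    · rintro _ ⟨i, p, q, hi, hit, ⟨z, h1, h2⟩, rfl⟩
      exact ⟨i * L + z, ⟨i, p, z, hi, hit, h1, rfl⟩, ⟨i, z, q, hi, hit, h2, rfl⟩⟩
  · refine Or.inl ⟨?_, hbdd⟩
    rintro ⟨x, y⟩ ⟨z, h1, h2⟩ ⟨x', y'⟩ ⟨z', h1', h2'⟩
    have hz : z = z' := by
      obtain ⟨i, p, q, hi, hit, hpq, e1⟩ := h1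
      obtain ⟨i', p', q', hi', hit', hpq', e2⟩ := h2
      obtain ⟨u, r, v, hu, hut, hrv, e3⟩ := h1'
      obtain ⟨u', r', v', hu', hut', hrv', e4⟩ := h2'
      have e1 := (Prod.ext_iff.1 e1).2
      have e2 := (Prod.ext_iff.1 e2).1
      have e3 := (Prod.ext_iff.1 e3).2
      have e4 := (Prod.ext_iff.1 e4).1
      dsimp only at e1 e2 e3 e4
      have hne : W i ≠ W i' := by rw [hit, hit']; exact hts
      rw [e1, e3]
      exact hW.meet_unique hk hT.pos hi hi' hu hu' (hT.bdd ha hpq).2 (hT.bdd hb hpq').1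
        (hT.bdd ha hrv).2 (hT.bdd hb hrv').1 (hit.trans hut.symm) (hit'.trans hut'.symm) hne
        (e1.symm.trans e2) (e3.symm.trans e4)
    subst hz
    exact Prod.ext (hai.2 h1 h1') (hbi.1 h2 h2')

end Lift

section Runs

variable {W : ℕ → ℕ} {n k : ℕ} {D : Finset ℕ}

/-- The point `x` is reached from the end of an occurrence of `t` through letters from `D`. -/
def RightRun (W : ℕ → ℕ) (n : ℕ) (D : Finset ℕ) (t x : ℕ) : Prop :=
  ∃ i < x, i < n ∧ W i = t ∧ ∀ j, i < j → j < x → W j ∈ D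

/-- The beginning of an occurrence of `t` is reached from `x` through letters from `D`. -/
def LeftRun (W : ℕ → ℕ) (n : ℕ) (D : Finset ℕ) (t x : ℕ) : Prop :=
  ∃ i, x ≤ i ∧ i < n ∧ W i = t ∧ ∀ j, x ≤ j → j < i → W j ∈ D

/-- A run of letters from a set of at most `k` letters is short. -/
theorem IsScattered.run_le (hW : IsScattered W n k) (hD : D.card ≤ k) {i m : ℕ} (him : i + m ≤ n)
    (h : ∀ j, i ≤ j → j < i + m → W j ∈ D) : m ≤ k := by
  by_contra hm
  have hcard := Finset.card_le_card_of_injOn (s := Finset.range (k + 1)) (t := D)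
    (fun j => W (i + j))
    (fun j hj => h _ (by omega) (by have := Finset.mem_range.1 hj; omega))
    (fun j hj j' hj' hjj => by
      have h1 := Finset.mem_range.1 hj
      have h2 := Finset.mem_range.1 hj'
      have := hW.eq_of_near (i := i + j) (j := i + j') (by omega) (by omega) hjj (by omega)
        (by omega)
      omega)
  rw [Finset.card_range] at hcard
  omega

theorem rightRun_succ_iff {t i : ℕ} (hiD : W i ∈ D) (hit : W i ≠ t) :
    RightRun W n D t (i + 1) ↔ RightRun W n D t i := by
  constructor
  · rintro ⟨j, hj, hjn, hjt, hD⟩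
    have hji : j ≠ i := by rintro rfl; exact hit hjt
    exact ⟨j, by omega, hjn, hjt, fun l h1 h2 => hD l h1 (by omega)⟩
  · rintro ⟨j, hj, hjn, hjt, hD⟩
    refine ⟨j, by omega, hjn, hjt, fun l h1 h2 => ?_⟩
    rcases Nat.lt_succ_iff_lt_or_eq.1 h2 with h3 | rfl
    · exact hD l h1 h3
    · exact hiD

theorem leftRun_succ_iff {t i : ℕ} (hiD : W i ∈ D) (hit : W i ≠ t) :
    LeftRun W n D t (i + 1) ↔ LeftRun W n D t i := by
  constructor
  · rintro ⟨j, hj, hjn, hjt, hD⟩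
    refine ⟨j, by omega, hjn, hjt, fun l h1 h2 => ?_⟩
    rcases Nat.eq_or_lt_of_le h1 with rfl | h3
    · exact hiD
    · exact hD l h3 h2
  · rintro ⟨j, hj, hjn, hjt, hD⟩
    have hji : j ≠ i := by rintro rfl; exact hit hjt
    exact ⟨j, by omega, hjn, hjt, fun l h1 h2 => hD l (by omega) h2⟩

theorem rightRun_after {i : ℕ} (hi : i < n) : RightRun W n D (W i) (i + 1) :=
  ⟨i, by omega, hi, rfl, fun j h1 h2 => by omega⟩

theorem leftRun_before {i : ℕ} (hi : i < n) : LeftRun W n D (W i) i :=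
  ⟨i, le_rfl, hi, rfl, fun j h1 h2 => by omega⟩

/-- The letters met along a run from one occurrence of a letter of `D` to a position with a letter
of `D`, inclusive, are at distance at most `k`. -/
theorem IsScattered.near_of_run (hW : IsScattered W n k) (hD : D.card ≤ k) {i j : ℕ} (hij : i ≤ j)
    (hj : j < n) (hiD : W i ∈ D) (hjD : W j ∈ D) (h : ∀ l, i < l → l < j → W l ∈ D) :
    j ≤ i + k := by
  have := hW.run_le hD (i := i) (m := j - i + 1) (by omega) (fun l h1 h2 => by
    rcases Nat.eq_or_lt_of_le h1 with rfl | h3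
    · exact hiD
    · rcases Nat.eq_or_lt_of_le (show l ≤ j by omega) with rfl | h4
      · exact hjD
      · exact h l h3 h4)
  omega

theorem IsScattered.not_rightRun (hW : IsScattered W n k) (hD : D.card ≤ k) {i : ℕ} (hi : i < n)
    (hiD : W i ∈ D) : ¬ RightRun W n D (W i) i := by
  rintro ⟨j, hj, hjn, hjt, hDj⟩
  have := hW.near_of_run hD hj.le hi (hjt ▸ hiD) hiD hDj
  have := hW.eq_of_near hjn hi hjt (by omega) (by omega)
  omega

theorem IsScattered.not_leftRun (hW : IsScattered W n k) (hD : D.card ≤ k) {i : ℕ} (hi : i < n)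
    (hiD : W i ∈ D) : ¬ LeftRun W n D (W i) (i + 1) := by
  rintro ⟨j, hj, hjn, hjt, hDj⟩
  have := hW.near_of_run hD (show i ≤ j by omega) hjn hiD (hjt ▸ hiD) (fun l h1 h2 => hDj l h1 h2)
  have := hW.eq_of_near hjn hi hjt (by omega) (by omega)
  omega

/-- A letter cannot lie both in a run to the right of `t` and in a run to the left of `t`. -/
theorem IsScattered.run_side (hW : IsScattered W n k) (hD : D.card ≤ k) {i i' t : ℕ} (hi : i < n)
    (hi' : i' < n) (hii : W i = W i') (hiD : W i ∈ D) (htD : t ∈ D)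
    (hr : RightRun W n D t i) (hl : LeftRun W n D t i') : False := by
  obtain ⟨j, hj, hjn, hjt, hDj⟩ := hr
  obtain ⟨j', hj', hjn', hjt', hDj'⟩ := hl
  have h1 := hW.near_of_run hD hj.le hi (hjt ▸ htD) hiD hDj
  have h2 := hW.near_of_run hD hj' hjn' (hii ▸ hiD) (hjt' ▸ htD) fun l h3 h4 => hDj' l h3.le h4
  have h3 := hW.eq_of_pair hi hjn hi' hjn' hii (hjt.trans hjt'.symm) (by omega) (by omega)
    (by omega) (by omega) (by omega)
  have h4 := hW.eq_of_pair hjn hi hjn' hi' (hjt.trans hjt'.symm) hii (by omega) (by omega)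
    (by omega) (by omega) (by omega)
  omega

end Runs

section Colourings

variable {W : ℕ → ℕ} {n k L : ℕ} {D : Finset ℕ} {Kt : ℕ → Finset (Set (ℕ × ℕ))}

/-- On the segments belonging to a letter of `D`, the colouring is either constant on each of them,
or repeats a fixed admissible pattern. -/
def IsGoodColouring (W : ℕ → ℕ) (n L : ℕ) (D : Finset ℕ) (Kt : ℕ → Finset (Set (ℕ × ℕ)))
    (c : ℕ → Bool) : Prop :=
  ∀ t ∈ D, (∀ i < n, W i = t → ∀ y ≤ L, c (i * L + y) = c (i * L)) ∨
    ∃ c₀, IsAdmissible c₀ (Kt t) ∧ ∀ i < n, W i = t → ∀ y ≤ L, c (i * L + y) = c₀ y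

/-- The colouring with the pattern `c₀` on all segments of the letter `t`, the other segments being
coloured by `o`. -/
def glueColouring (W : ℕ → ℕ) (n L t : ℕ) (c₀ o : ℕ → Bool) (x : ℕ) : Bool :=
  if x / L < n ∧ W (x / L) = t then c₀ (x % L) else o (x / L)

theorem segment_div_mod (hL : 0 < L) {y : ℕ} (i : ℕ) (hy : y < L) :
    (i * L + y) / L = i ∧ (i * L + y) % L = y := by
  constructor
  · rw [mul_comm, Nat.mul_add_div hL, Nat.div_eq_of_lt hy, add_zero]
  · rw [mul_comm, Nat.mul_add_mod, Nat.mod_eq_of_lt hy]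

/-- The conditions under which gluing is consistent. -/
structure IsGluing (W : ℕ → ℕ) (n L : ℕ) (D : Finset ℕ) (t : ℕ) (c₀ o : ℕ → Bool) : Prop where
  pos : 0 < L
  left : ∀ {i}, i < n → W i = t → o i = c₀ 0
  right : ∀ {i}, i < n → W i = t → o (i + 1) = c₀ L
  other : ∀ {i}, i < n → W i ∈ D → W i ≠ t → o (i + 1) = o i

namespace IsGluing

variable {t : ℕ} {c₀ o : ℕ → Bool}

theorem outer (h : IsGluing W n L D t c₀ o) (x : ℕ) : glueColouring W n L t c₀ o (x * L) = o x := by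
  obtain ⟨h1, h2⟩ := segment_div_mod h.pos x h.pos
  rw [add_zero] at h1 h2
  unfold glueColouring
  rw [h1, h2]
  split_ifs with h3
  · exact (h.left h3.1 h3.2).symm
  · rfl

theorem inner (h : IsGluing W n L D t c₀ o) {i y : ℕ} (hi : i < n) (hit : W i = t) (hy : y ≤ L) :
    glueColouring W n L t c₀ o (i * L + y) = c₀ y := by
  rcases hy.eq_or_lt with rfl | hy
  · rw [← Nat.succ_mul, h.outer, h.right hi hit]
  · obtain ⟨h1, h2⟩ := segment_div_mod h.pos i hy
    unfold glueColouring
    rw [h1, h2, if_pos ⟨hi, hit⟩]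

theorem flat (h : IsGluing W n L D t c₀ o) {i y : ℕ} (hi : i < n) (hiD : W i ∈ D) (hit : W i ≠ t)
    (hy : y ≤ L) : glueColouring W n L t c₀ o (i * L + y) = o i := by
  rcases hy.eq_or_lt with rfl | hy
  · rw [← Nat.succ_mul, h.outer, h.other hi hiD hit]
  · obtain ⟨h1, h2⟩ := segment_div_mod h.pos i hy
    unfold glueColouring
    rw [h1, h2, if_neg fun h3 => hit h3.2]

theorem isGood (h : IsGluing W n L D t c₀ o) (hc₀ : IsAdmissible c₀ (Kt t)) :
    IsGoodColouring W n L D Kt (glueColouring W n L t c₀ o) := by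
  intro s hs
  by_cases hst : s = t
  · subst hst
    exact Or.inr ⟨c₀, hc₀, fun i hi his y hy => h.inner hi his hy⟩
  · refine Or.inl fun i hi his y hy => ?_
    rw [h.outer, h.flat hi (his ▸ hs) (his ▸ hst) hy]

end IsGluing

open Classical in
theorem IsScattered.isGluing_right (hW : IsScattered W n k) (hD : D.card ≤ k) (hL : 0 < L) {t : ℕ}
    (ht : t ∈ D) (c₀ : ℕ → Bool) :
    IsGluing W n L D t c₀ fun x => if RightRun W n D t x then c₀ L else c₀ 0 where
  pos := hL
  left hi hit := by
    subst hit
    rw [if_neg (hW.not_rightRun hD hi ht)]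
  right hi hit := by
    subst hit
    rw [if_pos (rightRun_after hi)]
  other hi hiD hit := by rw [rightRun_succ_iff hiD hit]

open Classical in
theorem IsScattered.isGluing_left (hW : IsScattered W n k) (hD : D.card ≤ k) (hL : 0 < L) {t : ℕ}
    (ht : t ∈ D) (c₀ : ℕ → Bool) :
    IsGluing W n L D t c₀ fun x => if LeftRun W n D t x then c₀ 0 else c₀ L where
  pos := hL
  left hi hit := by
    subst hit
    rw [if_pos (leftRun_before hi)]
  right hi hit := by
    subst hit
    rw [if_neg (hW.not_leftRun hD hi ht)]
  other hi hiD hit := by rw [leftRun_succ_iff hiD hit]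

/-- Good colourings separate points. -/
theorem IsScattered.exists_good_points (hW : IsScattered W n k) (hD : D.card ≤ k) (hL : 0 < L)
    (hpts : ∀ t ∈ D, ∀ {j j'}, j ≤ L → j' ≤ L → j ≠ j' → ∃ c, IsAdmissible c (Kt t) ∧ c j ≠ c j')
    {j j' : ℕ} (hjj : j < j') (hj' : j' ≤ n * L) :
    ∃ c, IsGoodColouring W n L D Kt c ∧ c j ≠ c j' := by
  classical
  have hji := Nat.div_add_mod' j L
  have hy := Nat.mod_lt j hL
  set i := j / L with hidef
  set y := j % L with hydef
  have hi : i < n := by rw [Nat.div_lt_iff_lt_mul hL]; omega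
  by_cases hcut : ∃ i₂, i ≤ i₂ ∧ i₂ * L < j' ∧ W i₂ ∉ D
  · obtain ⟨i₂, h1, h2, h3⟩ := hcut
    refine ⟨fun x => decide (x ≤ max j (i₂ * L)), ?_, ?_⟩
    · refine fun t ht => Or.inl fun i₃ hi₃ hit z hz => ?_
      have hne : i₃ ≠ i₂ := by rintro rfl; exact h3 (hit ▸ ht)
      rcases lt_or_gt_of_ne hne with h4 | h4
      · have h5 : (i₃ + 1) * L ≤ i₂ * L := Nat.mul_le_mul_right L h4
        rw [Nat.succ_mul] at h5
        have h6 := le_max_right j (i₂ * L)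
        dsimp only
        rw [decide_eq_true (by omega), decide_eq_true (by omega)]
      · have h5 : (i₂ + 1) * L ≤ i₃ * L := Nat.mul_le_mul_right L h4
        have h6 : (i + 1) * L ≤ (i₂ + 1) * L := Nat.mul_le_mul_right L (by omega)
        rw [Nat.succ_mul] at h5
        rw [Nat.succ_mul, Nat.succ_mul] at h6
        have h7 : max j (i₂ * L) < i₃ * L := max_lt (by omega) (by omega)
        dsimp only
        rw [decide_eq_false (by omega), decide_eq_false (by omega)]
    · have h4 : ¬ j' ≤ max j (i₂ * L) := not_le.2 (max_lt hjj h2)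
      simp [h4]
  · push Not at hcut
    have hiD : W i ∈ D := hcut i le_rfl (by omega)
    by_cases hsame : j' ≤ (i + 1) * L
    · rw [Nat.succ_mul] at hsame
      obtain ⟨c₀, h1, h2⟩ := hpts _ hiD (j := y) (j' := j' - i * L) (by omega) (by omega) (by omega)
      have hg := hW.isGluing_right hD hL hiD c₀
      refine ⟨_, hg.isGood h1, ?_⟩
      have h3 : j' = i * L + (j' - i * L) := by omega
      rw [← hji, h3, hg.inner hi rfl hy.le, hg.inner hi rfl (by omega)]
      exact h2
    · obtain ⟨c₀, h1, h2⟩ := hpts _ hiD (j := y) (j' := L) hy.le le_rfl hy.ne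
      have hg := hW.isGluing_right hD hL hiD c₀
      refine ⟨_, hg.isGood h1, ?_⟩
      have hj'i := Nat.div_add_mod' (j' - 1) L
      have hz := Nat.mod_lt (j' - 1) hL
      set i' := (j' - 1) / L
      set z := (j' - 1) % L
      have hii' : i < i' := by
        rw [← Nat.succ_le_iff, Nat.le_div_iff_mul_le hL, Nat.succ_eq_add_one]; omega
      have hi' : i' < n := by rw [Nat.div_lt_iff_lt_mul hL]; omega
      have hi'D : W i' ∈ D := hcut i' hii'.le (by omega)
      have hrun : RightRun W n D (W i) i' := ⟨i, hii', hi, rfl, fun l h3 h4 =>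
        hcut l h3.le (lt_of_le_of_lt (Nat.mul_le_mul_right L h4.le) (by omega))⟩
      have hne : W i' ≠ W i := by
        intro h
        rw [← h] at hrun
        exact hW.not_rightRun hD hi' hi'D hrun
      have h3 : j' = i' * L + (z + 1) := by omega
      rw [← hji, h3, hg.inner hi rfl hy.le, hg.flat hi' hi'D hne (by omega), if_pos hrun]
      exact h2

/-- Good colourings separate the points of a segment of a letter of `D` from the segments of
another letter. -/
theorem IsScattered.exists_good_segment (hW : IsScattered W n k) (hD : D.card ≤ k) (hL : 0 < L)
    (hpts : ∀ t ∈ D, ∀ {j j'}, j ≤ L → j' ≤ L → j ≠ j' → ∃ c, IsAdmissible c (Kt t) ∧ c j ≠ c j')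
    {s i y : ℕ} (hs : s ∈ D) (hi : i < n) (hiD : W i ∈ D) (his : s ≠ W i) (hy : y ≤ L)
    (hside : (y ≠ 0 ∧ ∀ l < n, W l = s → ¬ RightRun W n D (W i) l) ∨
      (y ≠ L ∧ ∀ l < n, W l = s → ¬ LeftRun W n D (W i) l)) :
    ∃ c, IsGoodColouring W n L D Kt c ∧
      ∃ b, c (i * L + y) ≠ b ∧ ∀ l < n, W l = s → ∀ x ≤ L, c (l * L + x) = b := by
  classical
  rcases hside with ⟨hy0, hside⟩ | ⟨hyL, hside⟩
  · obtain ⟨c₀, h1, h2⟩ := hpts _ hiD (j := y) (j' := 0) hy (by omega) hy0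
    have hg := hW.isGluing_right hD hL hiD c₀
    refine ⟨_, hg.isGood h1, c₀ 0, by rwa [hg.inner hi rfl hy], fun l hl hls x hx => ?_⟩
    rw [hg.flat hl (hls ▸ hs) (hls ▸ his) hx, if_neg (hside l hl hls)]
  · obtain ⟨c₀, h1, h2⟩ := hpts _ hiD (j := y) (j' := L) hy le_rfl hyL
    have hg := hW.isGluing_left hD hL hiD c₀
    refine ⟨_, hg.isGood h1, c₀ L, by rwa [hg.inner hi rfl hy], fun l hl hls x hx => ?_⟩
    rw [hg.flat hl (hls ▸ hs) (hls ▸ his) hx, if_neg (hside l hl hls)]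

/-- Good colourings separate the segments of a letter of `D` from the points outside. -/
theorem IsScattered.exists_good_outside (hW : IsScattered W n k) (hD : D.card ≤ k) (hL : 0 < L)
    (hpts : ∀ t ∈ D, ∀ {j j'}, j ≤ L → j' ≤ L → j ≠ j' → ∃ c, IsAdmissible c (Kt t) ∧ c j ≠ c j')
    {s p : ℕ} (hs : s ∈ D) (hp : p ≤ n * L)
    (hout : ∀ i < n, W i = s → ∀ y ≤ L, p ≠ i * L + y) :
    ∃ c, IsGoodColouring W n L D Kt c ∧
      ∃ b, c p ≠ b ∧ ∀ l < n, W l = s → ∀ x ≤ L, c (l * L + x) = b := by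
  classical
  have hpi := Nat.div_add_mod' p L
  have hy := Nat.mod_lt p hL
  set i := p / L with hidef
  set y := p % L with hydef
  by_cases hy0 : y = 0
  · rw [hy0, add_zero] at hpi
    have hin : i ≤ n := by
      by_contra h
      have := Nat.mul_le_mul_right L (show n + 1 ≤ i by omega)
      rw [Nat.succ_mul] at this
      omega
    let o : ℕ → Bool := fun z => decide (∀ j, min i z ≤ j → j < max i z → W j ∈ D)
    by_cases hconn : ∃ l < n, W l = s ∧ o l = true
    · obtain ⟨l, hl, hls, hol⟩ := hconn
      have hol : ∀ j, min i l ≤ j → j < max i l → W j ∈ D := by simpa [o] using hol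
      rcases lt_trichotomy l i with hli | hli | hli
      · rw [min_eq_right hli.le, max_eq_left hli.le] at hol
        obtain ⟨q, hq⟩ := Nat.exists_eq_succ_of_ne_zero (show i ≠ 0 by omega)
        rw [hq, Nat.succ_eq_add_one, Nat.succ_mul] at hpi
        have hqD : W q ∈ D := hol q (by omega) (by omega)
        have hqs : s ≠ W q := fun h => hout q (by omega) h.symm L le_rfl hpi.symm
        rw [← hpi]
        refine hW.exists_good_segment hD hL hpts hs (by omega) hqD hqs le_rfl
          (Or.inl ⟨hL.ne', fun l' hl' hls' hr => ?_⟩)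
        refine hW.run_side hD hl' hl (hls'.trans hls.symm) (hls' ▸ hs) hqD hr
          ⟨q, by omega, by omega, rfl, fun j h1 h2 => hol j h1 (by omega)⟩
      · exact absurd hpi.symm (by simpa using hout i (hli ▸ hl) (hli ▸ hls) 0 (by omega))
      · rw [min_eq_left hli.le, max_eq_right hli.le] at hol
        have hiD : W i ∈ D := hol i le_rfl hli
        have his : s ≠ W i := fun h => hout i (by omega) h.symm 0 (by omega) (by omega)
        rw [← hpi, ← add_zero (i * L)]
        refine hW.exists_good_segment hD hL hpts hs (by omega) hiD his (by omega)
          (Or.inr ⟨hL.ne, fun l' hl' hls' hr => ?_⟩)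
        refine hW.run_side hD hl hl' (hls.trans hls'.symm) (hls ▸ hs) hiD
          ⟨i, hli, by omega, rfl, fun j h1 h2 => hol j h1.le h2⟩ hr
    · push Not at hconn
      have hstep : ∀ {l}, W l ∈ D → o (l + 1) = o l := by
        intro l hl
        simp only [o, decide_eq_decide]
        constructor
        · intro h j h1 h2
          by_cases hjl : j = l
          · exact hjl ▸ hl
          · exact h j (by omega) (by omega)
        · intro h j h1 h2
          by_cases hjl : j = l
          · exact hjl ▸ hl
          · exact h j (by omega) (by omega)
      have hfalse : ∀ {l}, l < n → W l = s → o l = false := fun hl hls => by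
        simpa using hconn _ hl hls
      have hg : IsGluing W n L D s (fun _ => false) o :=
        ⟨hL, fun hl hls => hfalse hl hls, fun hl hls => by
          rw [hstep (hls ▸ hs), hfalse hl hls], fun _ h _ => hstep h⟩
      refine ⟨_, hg.isGood fun a _ => Or.inl fun p _ => rfl, false, ?_, fun l hl hls x hx =>
        hg.inner hl hls hx⟩
      rw [← hpi, hg.outer]
      simp [o]
      intros
      omega
  · have hi : i < n := by 
      by_contra h
      have := Nat.mul_le_mul_right L (not_lt.1 h)
      omega
    have his : s ≠ W i := fun h => hout i hi h.symm y hy.le hpi.symm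
    by_cases hiD : W i ∈ D
    · rw [← hpi]
      refine hW.exists_good_segment hD hL hpts hs hi hiD his hy.le ?_
      by_contra hcon
      push Not at hcon
      obtain ⟨l, hl, hls, hr⟩ := hcon.1 hy0
      obtain ⟨l', hl', hls', hr'⟩ := hcon.2 hy.ne
      exact hW.run_side hD hl hl' (hls.trans hls'.symm) (hls ▸ hs) hiD hr hr'
    · have hfar : ∀ l, W l ∈ D → ∀ x ≤ L, l * L + x ≠ p := by
        intro l hlD x hx h
        rw [← hpi] at h
        rcases lt_trichotomy l i with h1 | h1 | h1
        · have := (segment_cases hL hx hy.le h h1).2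
          omega
        · exact hiD (h1 ▸ hlD)
        · have := (segment_cases hL hy.le hx h.symm h1).1
          subst this
          rw [Nat.succ_mul] at h
          omega
      refine ⟨fun x => decide (x = p), fun t ht => Or.inl fun l hl hlt x hx => ?_, false, by simp,
        fun l hl hls x hx => ?_⟩
      · have h1 := hfar l (hlt ▸ ht) x hx
        have h2 := hfar l (hlt ▸ ht) 0 (by omega)
        rw [add_zero] at h2
        simp [h1, h2]
      · simpa using hfar l (hls ▸ hs) x hx

end Colourings

section Extend

variable {W : ℕ → ℕ} {n k L : ℕ} {T : Set (Set (ℕ × ℕ))}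

/-- A finite part of `extendRels W n L T` involves few letters and few members of `T`. -/
theorem exists_letters {K : Finset (Set (ℕ × ℕ))} (hK : ∀ a ∈ K, a ∈ extendRels W n L T) :
    ∃ (D : Finset ℕ) (Kt : ℕ → Finset (Set (ℕ × ℕ))), D.card ≤ K.card ∧
      (∀ t, (∀ a ∈ Kt t, a ∈ T) ∧ (Kt t).card ≤ K.card) ∧
      ∀ b ∈ K, b.Subsingleton ∨ ∃ t ∈ D, ∃ a ∈ Kt t, b = liftRel W n L t a := by
  classical
  have hex : ∀ b : Set (ℕ × ℕ), ∃ (t : ℕ) (a : Set (ℕ × ℕ)), b ∈ K → ¬ b.Subsingleton →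
      a ∈ T ∧ b = liftRel W n L t a := by
    intro b
    by_cases hb : b ∈ K ∧ ¬ b.Subsingleton
    · rcases hK b hb.1 with h | ⟨t, a, ha, h⟩
      · exact absurd h.1 hb.2
      · exact ⟨t, a, fun _ _ => ⟨ha, h⟩⟩
    · exact ⟨0, ∅, fun h1 h2 => absurd ⟨h1, h2⟩ hb⟩
  choose tt aa htt using hex
  refine ⟨K.image tt, fun t => (K.filter fun b => ¬ b.Subsingleton ∧ tt b = t).image aa,
    Finset.card_image_le, fun t => ⟨fun a ha => ?_, ?_⟩, fun b hb => ?_⟩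
  · obtain ⟨b, hb, rfl⟩ := Finset.mem_image.1 ha
    obtain ⟨h1, h2, -⟩ := Finset.mem_filter.1 hb
    exact (htt b h1 h2).1
  · exact Finset.card_image_le.trans (Finset.card_filter_le _ _)
  · by_cases hs : b.Subsingleton
    · exact Or.inl hs
    · exact Or.inr ⟨tt b, Finset.mem_image_of_mem _ hb, aa b,
        Finset.mem_image_of_mem _ (Finset.mem_filter.2 ⟨hb, hs, rfl⟩), (htt b hb hs).2⟩

theorem IsGoodColouring.isAdmissible (hT : IsSeparated L T k) {D : Finset ℕ}
    {Kt : ℕ → Finset (Set (ℕ × ℕ))} {K : Finset (Set (ℕ × ℕ))} {c : ℕ → Bool}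
    (hc : IsGoodColouring W n L D Kt c) (hKt : ∀ t, ∀ a ∈ Kt t, a ∈ T)
    (hK : ∀ b ∈ K, b.Subsingleton ∨ ∃ t ∈ D, ∃ a ∈ Kt t, b = liftRel W n L t a) :
    IsAdmissible c K := by
  intro b hb
  rcases hK b hb with h | ⟨t, ht, a, ha, rfl⟩
  · exact Or.inr (isUniform_of_subsingleton c h)
  rcases hc t ht with h | ⟨c₀, hc₀, h⟩
  · left
    rintro _ ⟨i, x, y, hi, hit, hxy, rfl⟩
    have hb := hT.bdd (hKt t a ha) hxy
    exact (h i hi hit x hb.1).trans (h i hi hit y hb.2).symm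
  · refine (hc₀ a ha).imp (fun hf => ?_) fun hu => ?_
    · rintro _ ⟨i, x, y, hi, hit, hxy, rfl⟩
      have hb := hT.bdd (hKt t a ha) hxy
      dsimp only
      rw [h i hi hit x hb.1, h i hi hit y hb.2]
      exact hf _ hxy
    · rintro _ ⟨i, x, y, hi, hit, hxy, rfl⟩ _ ⟨i', x', y', hi', hit', hxy', rfl⟩
      have hb := hT.bdd (hKt t a ha) hxy
      have hb' := hT.bdd (hKt t a ha) hxy'
      dsimp only
      rw [h i hi hit x hb.1, h i hi hit y hb.2, h i' hi' hit' x' hb'.1, h i' hi' hit' y' hb'.2]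
      exact hu _ hxy _ hxy'

theorem extendRels_points (hW : IsScattered W n k) (hT : IsSeparated L T k)
    {K : Finset (Set (ℕ × ℕ))} (hK : ∀ a ∈ K, a ∈ extendRels W n L T) (hKk : K.card ≤ k)
    {j j' : ℕ} (hj : j ≤ n * L) (hj' : j' ≤ n * L) (hne : j ≠ j') :
    ∃ c, IsAdmissible c K ∧ c j ≠ c j' := by
  obtain ⟨D, Kt, hD, hKt, hKD⟩ := exists_letters hK
  have hpts : ∀ t ∈ D, ∀ {j j'}, j ≤ L → j' ≤ L → j ≠ j' →
      ∃ c, IsAdmissible c (Kt t) ∧ c j ≠ c j' := fun t _ _ _ h1 h2 h3 =>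
    hT.points (hKt t).1 ((hKt t).2.trans hKk) h1 h2 h3
  rcases lt_or_gt_of_ne hne with h | h
  · obtain ⟨c, h1, h2⟩ := hW.exists_good_points (hD.trans hKk) hT.pos hpts h hj'
    exact ⟨c, h1.isAdmissible hT (fun t => (hKt t).1) hKD, h2⟩
  · obtain ⟨c, h1, h2⟩ := hW.exists_good_points (hD.trans hKk) hT.pos hpts h hj
    exact ⟨c, h1.isAdmissible hT (fun t => (hKt t).1) hKD, h2.symm⟩

theorem extendRels_dom (hW : IsScattered W n k) (hT : IsSeparated L T k)
    {K : Finset (Set (ℕ × ℕ))} (hK : ∀ a ∈ K, a ∈ extendRels W n L T) (hKk : K.card ≤ k)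
    {a : Set (ℕ × ℕ)} (ha : a ∈ K) {l : ℕ} (hl : l ≤ n * L) (hla : ∀ y, (l, y) ∉ a) :
    ∃ c, IsAdmissible c K ∧ IsUniform c a ∧ ∀ p ∈ a, c p.1 ≠ c l := by
  classical
  by_cases has : a.Subsingleton
  · rcases a.eq_empty_or_nonempty with rfl | ⟨p, hp⟩
    · refine ⟨fun _ => false, fun b _ => Or.inl fun _ _ => rfl, ?_, ?_⟩
      · exact isUniform_of_subsingleton _ has
      · simp
    · have hpl : p.1 ≠ l := fun h => hla p.2 (h ▸ hp)
      obtain ⟨c, h1, h2⟩ := extendRels_points hW hT hK hKk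
        (extendRels_bdd hT (hK a ha) (x := p.1) (y := p.2) hp).1 hl hpl
      exact ⟨c, h1, isUniform_of_subsingleton c has, fun q hq => has hp hq ▸ h2⟩
  obtain ⟨D, Kt, hD, hKt, hKD⟩ := exists_letters hK
  have hpts : ∀ t ∈ D, ∀ {j j'}, j ≤ L → j' ≤ L → j ≠ j' →
      ∃ c, IsAdmissible c (Kt t) ∧ c j ≠ c j' := fun t _ _ _ h1 h2 h3 =>
    hT.points (hKt t).1 ((hKt t).2.trans hKk) h1 h2 h3
  obtain ⟨s, hs, b, hb, rfl⟩ := (hKD a ha).resolve_left has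
  have hbT := (hKt s).1 b hb
  by_cases hin : ∃ i < n, W i = s ∧ ∃ y ≤ L, l = i * L + y
  · obtain ⟨i, hi, his, y, hy, rfl⟩ := hin
    obtain ⟨c₀, h1, h2, h3⟩ := hT.dom (hKt s).1 ((hKt s).2.trans hKk) b hb y hy fun z hz =>
      hla (i * L + z) ⟨i, y, z, hi, his, hz, rfl⟩
    have hg := hW.isGluing_right (hD.trans hKk) hT.pos hs c₀
    refine ⟨_, (hg.isGood h1).isAdmissible hT (fun t => (hKt t).1) hKD, ?_, ?_⟩
    · rintro _ ⟨u, x, z, hu, hus, hxz, rfl⟩ _ ⟨u', x', z', hu', hus', hxz', rfl⟩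
      have hb := hT.bdd hbT hxz
      have hb' := hT.bdd hbT hxz'
      dsimp only
      rw [hg.inner hu hus hb.1, hg.inner hu hus hb.2, hg.inner hu' hus' hb'.1,
        hg.inner hu' hus' hb'.2]
      exact h2 _ hxz _ hxz'
    · rintro _ ⟨u, x, z, hu, hus, hxz, rfl⟩
      rw [hg.inner hi his hy, hg.inner hu hus (hT.bdd hbT hxz).1]
      exact h3 _ hxz
  · push Not at hin
    obtain ⟨c, h1, v, h2, h3⟩ := hW.exists_good_outside (hD.trans hKk) hT.pos hpts hs hl hin
    refine ⟨c, h1.isAdmissible hT (fun t => (hKt t).1) hKD, ?_, ?_⟩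
    · rintro _ ⟨u, x, z, hu, hus, hxz, rfl⟩ _ ⟨u', x', z', hu', hus', hxz', rfl⟩
      have hb := hT.bdd hbT hxz
      have hb' := hT.bdd hbT hxz'
      dsimp only
      rw [h3 u hu hus x hb.1, h3 u hu hus z hb.2, h3 u' hu' hus' x' hb'.1, h3 u' hu' hus' z' hb'.2]
      exact ⟨rfl, rfl⟩
    · rintro _ ⟨u, x, z, hu, hus, hxz, rfl⟩
      rw [h3 u hu hus x (hT.bdd hbT hxz).1]
      exact h2.symm

theorem extendRels_isSeparated (hW : IsScattered W n k) (hk : 1 ≤ k) (hn : 0 < n)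
    (hT : IsSeparated L T k) : IsSeparated (n * L) (extendRels W n L T) k where
  pos := Nat.mul_pos hn hT.pos
  bdd ha _ _ := extendRels_bdd hT ha
  inj := extendRels_inj hW hk hT
  inter := extendRels_inter hW hk hT
  comp := extendRels_comp hW hk hT
  points hK hKk _ _ := extendRels_points hW hT hK hKk
  dom hK hKk _ ha _ hl := extendRels_dom hW hT hK hKk ha hl

end Extend

/-! ### Identities of the Brandt monoid in separated systems -/

/-- An upper bound for the variables of a term. -/
def SemiringTerm.bound : SemiringTerm → ℕ
  | .var i => i + 1
  | .add s t => max s.bound t.bound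
  | .mul s t => max s.bound t.bound

namespace BrandtMonoid

/-- The relation on two points given by the nonzero entries of a matrix. -/
def Rel (A : BrandtMonoid) (x y : Fin 2) : Prop := A.1 x y ≠ 0

theorem rel_add {A B : BrandtMonoid} {x y : Fin 2} : (A + B).Rel x y ↔ A.Rel x y ∧ B.Rel x y := by
  change A.1 x y * B.1 x y ≠ 0 ↔ _
  rw [mul_ne_zero_iff]
  rfl

theorem rel_mul {A B : BrandtMonoid} {x y : Fin 2} :
    (A * B).Rel x y ↔ ∃ z, A.Rel x z ∧ B.Rel z y := by
  change (A.1 * B.1) x y ≠ 0 ↔ _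
  rw [Matrix.mul_apply, Ne, Finset.sum_eq_zero_iff]
  simp [Rel, not_or]
  tauto

theorem row_entries : ∀ A ∈ brandtMatrices,
    (A 0 0 = 0 ∨ A 0 1 = 0) ∧ (A 1 0 = 0 ∨ A 1 1 = 0) := by
  decide

theorem Rel.unique {A : BrandtMonoid} {x y z : Fin 2} (h : A.Rel x y) (h' : A.Rel x z) : y = z := by
  have := row_entries A.1 A.2
  unfold Rel at h h'
  fin_cases x <;> fin_cases y <;> fin_cases z <;> simp_all

/-- The matrix unit with the nonzero entry in the position `(x, y)`. -/
def unit (x y : Fin 2) : BrandtMonoid :=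
  ⟨Matrix.of fun u v => if u = x ∧ v = y then 1 else 0, by revert x y; decide⟩

theorem rel_unit {x y u v : Fin 2} : (unit x y).Rel u v ↔ u = x ∧ v = y := by
  change (if u = x ∧ v = y then 1 else 0) ≠ 0 ↔ _
  simp

/-- The identity matrix. -/
def identity : BrandtMonoid := ⟨1, by decide⟩

theorem rel_identity (u : Fin 2) : identity.Rel u u := by
  change (1 : Matrix (Fin 2) (Fin 2) ℕ) u u ≠ 0
  simp

/-- The zero matrix. -/
def zero : BrandtMonoid := ⟨0, by decide⟩

theorem not_rel_zero (u v : Fin 2) : ¬ zero.Rel u v := fun h => h rfl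

/-- A colour as one of two points. -/
def point (b : Bool) : Fin 2 := if b then 1 else 0

theorem point_injective : Function.Injective point := by decide

open Classical in
/-- The image of a relation under a two-colouring, replaced by the identity if the relation is
not uniform. -/
noncomputable def image (c : ℕ → Bool) (a : Set (ℕ × ℕ)) : BrandtMonoid :=
  if IsUniform c a then
    if h : a.Nonempty then unit (point (c h.some.1)) (point (c h.some.2)) else zero
  else identity

theorem rel_image_of_mem {c : ℕ → Bool} {a : Set (ℕ × ℕ)} (ha : IsFlat c a ∨ IsUniform c a)
    {x y : ℕ} (h : (x, y) ∈ a) : (image c a).Rel (point (c x)) (point (c y)) := by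
  by_cases h1 : IsUniform c a
  · have h2 : a.Nonempty := ⟨_, h⟩
    obtain ⟨h3, h4⟩ := h1 _ h _ h2.some_mem
    rw [image, if_pos h1, dif_pos h2, rel_unit, ← h3, ← h4]
    exact ⟨rfl, rfl⟩
  · have h3 : c x = c y := (ha.resolve_right h1) _ h
    rw [image, if_neg h1, h3]
    exact rel_identity _

theorem exists_mem_of_rel_image {c : ℕ → Bool} {a : Set (ℕ × ℕ)} (ha : IsUniform c a)
    {x y : Fin 2} (h : (image c a).Rel x y) : ∃ p ∈ a, x = point (c p.1) := by
  rw [image, if_pos ha] at h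
  split_ifs at h with h1
  · exact ⟨h1.some, h1.some_mem, (rel_unit.1 h).1⟩
  · exact absurd h (not_rel_zero _ _)

end BrandtMonoid

namespace IsSeparated

variable {L k : ℕ} {T : Set (Set (ℕ × ℕ))}

/-- The ai-semiring on a separated system of partial injections: the sum is the intersection, the
product is the composition. -/
abbrev semiring (hT : IsSeparated L T k) : AISemiring {a // a ∈ T} where
  add a b := ⟨a.1 ∩ b.1, hT.inter a.2 b.2⟩
  mul a b := ⟨relComp a.1 b.1, hT.comp a.2 b.2⟩
  add_assoc a b c := Subtype.ext (Set.inter_assoc _ _ _)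
  add_comm a b := Subtype.ext (Set.inter_comm _ _)
  mul_assoc a b c := Subtype.ext (by
    ext p
    constructor
    · rintro ⟨z, ⟨w, h1, h2⟩, h3⟩
      exact ⟨w, h1, z, h2, h3⟩
    · rintro ⟨w, h1, z, h2, h3⟩
      exact ⟨z, ⟨w, h1, h2⟩, h3⟩)
  left_distrib a b c := Subtype.ext (by
    ext p
    constructor
    · rintro ⟨z, h1, h2, h3⟩
      exact ⟨⟨z, h1, h2⟩, ⟨z, h1, h3⟩⟩
    · rintro ⟨⟨z, h1, h2⟩, ⟨w, h3, h4⟩⟩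
      obtain rfl := (hT.inj a.2).1 h1 h3
      exact ⟨z, h1, h2, h4⟩)
  right_distrib a b c := Subtype.ext (by
    ext p
    constructor
    · rintro ⟨z, ⟨h1, h2⟩, h3⟩
      exact ⟨⟨z, h1, h3⟩, ⟨z, h2, h3⟩⟩
    · rintro ⟨⟨z, h1, h2⟩, ⟨w, h3, h4⟩⟩
      obtain rfl := (hT.inj c.2).2 h2 h4
      exact ⟨z, ⟨h1, h3⟩, h2⟩)
  add_idem a := Subtype.ext (Set.inter_self _)

theorem rel_eval (hT : IsSeparated L T k) {τ : ℕ → {a // a ∈ T}} {c : ℕ → Bool}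
    (hc : ∀ i < k, IsFlat c (τ i).1 ∨ IsUniform c (τ i).1) :
    let := hT.semiring
    ∀ t : SemiringTerm, t.bound ≤ k → ∀ {x y}, (x, y) ∈ (t.eval τ).1 →
      (t.eval fun i => BrandtMonoid.image c (τ i).1).Rel
        (BrandtMonoid.point (c x)) (BrandtMonoid.point (c y)) := by
  intro _ t
  induction t with
  | var i => exact fun h _ _ hxy => BrandtMonoid.rel_image_of_mem (hc i h) hxy
  | add s t ihs iht =>
    intro h x y hxy
    obtain ⟨h1, h2⟩ := max_le_iff.1 h
    exact BrandtMonoid.rel_add.2 ⟨ihs h1 hxy.1, iht h2 hxy.2⟩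
  | mul s t ihs iht =>
    intro h x y hxy
    obtain ⟨h1, h2⟩ := max_le_iff.1 h
    obtain ⟨z, h3, h4⟩ := hxy
    exact BrandtMonoid.rel_mul.2 ⟨_, ihs h1 h3, iht h2 h4⟩

theorem exists_dom (hT : IsSeparated L T k) (τ : ℕ → {a // a ∈ T}) :
    let := hT.semiring
    ∀ t : SemiringTerm, t.bound ≤ k → ∀ {x}, x ≤ L → (∀ y, (x, y) ∉ (t.eval τ).1) →
      ∃ c, (∀ i < k, IsFlat c (τ i).1 ∨ IsUniform c (τ i).1) ∧
        ∀ z, ¬ (t.eval fun i => BrandtMonoid.image c (τ i).1).Rel (BrandtMonoid.point (c x)) z := by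
  classical
  intro _ t
  set K : Finset (Set (ℕ × ℕ)) := (Finset.range k).image fun i => (τ i).1 with hKdef
  have hKT : ∀ a ∈ K, a ∈ T := fun a ha => by
    obtain ⟨i, -, rfl⟩ := Finset.mem_image.1 ha
    exact (τ i).2
  have hKk : K.card ≤ k := Finset.card_image_le.trans (Finset.card_range k).le
  have hmem : ∀ i < k, (τ i).1 ∈ K := fun i hi =>
    Finset.mem_image_of_mem (fun i => (τ i).1) (Finset.mem_range.2 hi)
  induction t with
  | var i =>
    intro h x hx hxy
    obtain ⟨c, h1, h2, h3⟩ := hT.dom hKT hKk _ (hmem i h) x hx hxy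
    refine ⟨c, fun j hj => h1 _ (hmem j hj), fun z hz => ?_⟩
    obtain ⟨p, hp, heq⟩ := BrandtMonoid.exists_mem_of_rel_image h2 hz
    exact h3 p hp (BrandtMonoid.point_injective heq).symm
  | add s t ihs iht =>
    intro h x hx hxy
    obtain ⟨hs, ht⟩ := max_le_iff.1 h
    by_cases h1 : ∃ y, (x, y) ∈ (s.eval τ).1
    · by_cases h2 : ∃ y, (x, y) ∈ (t.eval τ).1
      · obtain ⟨y, hy⟩ := h1
        obtain ⟨y', hy'⟩ := h2
        have hne : y ≠ y' := by
          rintro rfl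
          exact hxy y ⟨hy, hy'⟩
        obtain ⟨c, h3, h4⟩ := hT.points hKT hKk (hT.bdd (s.eval τ).2 hy).2
          (hT.bdd (t.eval τ).2 hy').2 hne
        have hc : ∀ i < k, IsFlat c (τ i).1 ∨ IsUniform c (τ i).1 := fun j hj => h3 _ (hmem j hj)
        refine ⟨c, hc, fun z hz => ?_⟩
        obtain ⟨h5, h6⟩ := BrandtMonoid.rel_add.1 hz
        exact h4 (BrandtMonoid.point_injective
          (((hT.rel_eval hc s hs hy).unique h5).trans ((hT.rel_eval hc t ht hy').unique h6).symm))
      · push Not at h2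
        obtain ⟨c, hc, h3⟩ := iht ht hx h2
        exact ⟨c, hc, fun z hz => h3 z (BrandtMonoid.rel_add.1 hz).2⟩
    · push Not at h1
      obtain ⟨c, hc, h3⟩ := ihs hs hx h1
      exact ⟨c, hc, fun z hz => h3 z (BrandtMonoid.rel_add.1 hz).1⟩
  | mul s t ihs iht =>
    intro h x hx hxy
    obtain ⟨hs, ht⟩ := max_le_iff.1 h
    by_cases h1 : ∃ y, (x, y) ∈ (s.eval τ).1
    · obtain ⟨y, hy⟩ := h1
      obtain ⟨c, hc, h3⟩ := iht ht (hT.bdd (s.eval τ).2 hy).2 fun z hz => hxy z ⟨y, hy, hz⟩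
      refine ⟨c, hc, fun z hz => ?_⟩
      obtain ⟨w, h4, h5⟩ := BrandtMonoid.rel_mul.1 hz
      rw [← (hT.rel_eval hc s hs hy).unique h4] at h5
      exact h3 z h5
    · push Not at h1
      obtain ⟨c, hc, h3⟩ := ihs hs hx h1
      refine ⟨c, hc, fun z hz => ?_⟩
      obtain ⟨w, h4, -⟩ := BrandtMonoid.rel_mul.1 hz
      exact h3 w h4

/-- Identities of the Brandt monoid in at most `k` variables hold in the semiring of a separated
system. -/
theorem holdsIn (hT : IsSeparated L T k) {p : SemiringIdentity} (hl : p.lhs.bound ≤ k)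
    (hr : p.rhs.bound ≤ k) (hp : p.HoldsIn BrandtMonoid) :
    let := hT.semiring
    p.HoldsIn {a // a ∈ T} := by
  classical
  intro _ τ
  have key : ∀ s t : SemiringTerm, s.bound ≤ k → t.bound ≤ k →
      (∀ σ : ℕ → BrandtMonoid, s.eval σ = t.eval σ) → (s.eval τ).1 ⊆ (t.eval τ).1 := by
    rintro s t hs ht hst ⟨x, y⟩ hxy
    by_contra hcon
    have hb := hT.bdd (s.eval τ).2 hxy
    by_cases h1 : ∃ z, (x, z) ∈ (t.eval τ).1
    · obtain ⟨z, hz⟩ := h1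
      have hne : y ≠ z := by rintro rfl; exact hcon hz
      obtain ⟨c, h3, h4⟩ := hT.points (K := (Finset.range k).image fun i => (τ i).1) (by
        intro a ha
        obtain ⟨i, -, rfl⟩ := Finset.mem_image.1 ha
        exact (τ i).2) (Finset.card_image_le.trans (Finset.card_range k).le) hb.2
        (hT.bdd (t.eval τ).2 hz).2 hne
      have hc : ∀ i < k, IsFlat c (τ i).1 ∨ IsUniform c (τ i).1 := fun j hj =>
        h3 _ (Finset.mem_image_of_mem (fun i => (τ i).1) (Finset.mem_range.2 hj))
      have h5 := hT.rel_eval hc s hs hxy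
      rw [hst] at h5
      exact h4 (BrandtMonoid.point_injective (h5.unique (hT.rel_eval hc t ht hz)))
    · push Not at h1
      obtain ⟨c, hc, h3⟩ := hT.exists_dom τ t ht hb.1 h1
      have h5 := hT.rel_eval hc s hs hxy
      rw [hst] at h5
      exact h3 _ h5
  exact Subtype.ext (Set.Subset.antisymm (key _ _ hl hr hp) (key _ _ hr hl fun σ => (hp σ).symm))

end IsSeparated

/-! ### Nested words -/

/-- The product of the terms `f 0, …, f m`. -/
def prodTerm (f : ℕ → SemiringTerm) : ℕ → SemiringTerm
  | 0 => f 0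
  | m + 1 => .mul (prodTerm f m) (f (m + 1))

/-- The word obtained from the word `W 0 ⋯ W m` by iterating `h` times the substitution of copies in
disjoint sets of variables for the letters. The variables are renamed according to `g`. -/
def nestedWord (W : ℕ → ℕ) (m : ℕ) : ℕ → (ℕ → ℕ) → SemiringTerm
  | 0, g => .var (g 0)
  | h + 1, g => prodTerm (fun i => nestedWord W m h fun x => g (Nat.pair (W i) x)) m

/-- The length of the nested word over a word of length `n`. -/
def nestedLength (n : ℕ) : ℕ → ℕ
  | 0 => 1
  | h + 1 => n * nestedLength n h

/-- The system of partial injections that acts along the nested word. -/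
def nestedRels (W : ℕ → ℕ) (n : ℕ) : ℕ → Set (Set (ℕ × ℕ))
  | 0 => smallRels 1
  | h + 1 => extendRels W n (nestedLength n h) (nestedRels W n h)

/-- The partial injections given by the letters of the nested word. -/
def nestedLetter (W : ℕ → ℕ) (n : ℕ) : ℕ → ℕ → Set (ℕ × ℕ)
  | 0, _ => {(0, 1)}
  | h + 1, x => liftRel W n (nestedLength n h) x.unpair.1 (nestedLetter W n h x.unpair.2)

theorem nestedRels_isSeparated {W : ℕ → ℕ} {n k : ℕ} (hW : IsScattered W n k) (hk : 1 ≤ k)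
    (hn : 0 < n) : ∀ h, IsSeparated (nestedLength n h) (nestedRels W n h) k
  | 0 => smallRels_isSeparated one_pos k
  | h + 1 => extendRels_isSeparated hW hk hn (nestedRels_isSeparated hW hk hn h)

theorem nestedLetter_mem (W : ℕ → ℕ) (n : ℕ) : ∀ h x, nestedLetter W n h x ∈ nestedRels W n h
  | 0, _ => ⟨Set.subsingleton_singleton, fun x y h => by
      obtain ⟨rfl, rfl⟩ := Prod.ext_iff.1 h
      simp⟩
  | h + 1, x => Or.inr ⟨_, _, nestedLetter_mem W n h _, rfl⟩

theorem mem_eval_prodTerm {L k : ℕ} {T : Set (Set (ℕ × ℕ))} (hT : IsSeparated L T k)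
    (τ : ℕ → {a // a ∈ T}) {f : ℕ → SemiringTerm} {d l : ℕ} (m : ℕ) :
    let := hT.semiring
    (∀ i ≤ m, (d + i * l, d + i * l + l) ∈ ((f i).eval τ).1) →
      (d, d + (m + 1) * l) ∈ ((prodTerm f m).eval τ).1 := by
  intro _
  induction m with
  | zero =>
    intro h
    simpa [prodTerm] using h 0 le_rfl
  | succ m ih =>
    intro h
    have h1 := h (m + 1) le_rfl
    have h2 : d + (m + 1 + 1) * l = d + (m + 1) * l + l := by ring
    rw [h2]
    exact ⟨_, ih fun i hi => h i (by omega), h1⟩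

theorem mem_eval_nestedWord {W : ℕ → ℕ} {m L k : ℕ} {T : Set (Set (ℕ × ℕ))}
    (hT : IsSeparated L T k) (τ : ℕ → {a // a ∈ T}) :
    let := hT.semiring
    ∀ (h : ℕ) (g : ℕ → ℕ) (d : ℕ),
      (∀ x u v, (u, v) ∈ nestedLetter W (m + 1) h x → (d + u, d + v) ∈ (τ (g x)).1) →
      (d, d + nestedLength (m + 1) h) ∈ ((nestedWord W m h g).eval τ).1 := by
  intro _ h
  induction h with
  | zero =>
    intro g d hd
    exact hd 0 0 1 rfl
  | succ h ih =>
    intro g d hd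
    refine mem_eval_prodTerm hT τ m fun i hi => ih _ _ fun x u v huv => ?_
    rw [add_assoc, add_assoc]
    exact hd _ _ _ ⟨i, u, v, by omega, by simp, by simpa using huv, rfl⟩

/-- In the system of partial injections acting along it, a nested word is not idempotent. -/
theorem nestedWord_not_idem {W : ℕ → ℕ} {m k : ℕ} (hW : IsScattered W (m + 1) k) (hk : 1 ≤ k)
    (h : ℕ) :
    let := (nestedRels_isSeparated hW hk m.succ_pos h).semiring
    ¬ SemiringIdentity.HoldsIn ⟨nestedWord W m h id, .mul (nestedWord W m h id)
      (nestedWord W m h id)⟩ {a // a ∈ nestedRels W (m + 1) h} := by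
  intro _ hcon
  have hT := nestedRels_isSeparated hW hk m.succ_pos h
  let τ : ℕ → {a // a ∈ nestedRels W (m + 1) h} := fun x => ⟨_, nestedLetter_mem W (m + 1) h x⟩
  have h1 := mem_eval_nestedWord hT τ h id 0 fun x u v huv => by simpa [τ] using huv
  rw [zero_add] at h1
  have h2 := h1
  rw [show (nestedWord W m h id).eval τ = _ from hcon τ] at h2
  obtain ⟨z, h3, h4⟩ := h2
  have hinj := hT.inj ((nestedWord W m h id).eval τ).2
  have h5 : z = nestedLength (m + 1) h := hinj.1 h3 h1
  subst h5
  exact hT.pos.ne (hinj.2 h1 h4)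

theorem coe_eval_prodTerm {S : Type u} [AISemiring S] (τ : ℕ → S) (f : ℕ → SemiringTerm) (m : ℕ) :
    (((prodTerm f m).eval τ : S) : WithOne S) =
      seqProd (fun i => (((f i).eval τ : S) : WithOne S)) (m + 1) := by
  induction m with
  | zero => simp [prodTerm, seqProd_succ]
  | succ m ih =>
    rw [seqProd_succ, ← ih]
    rfl

/-! ### Transfer to the monoid with an adjoined neutral element -/

theorem IsBlockGroup.withOne {S : Type u} [Semigroup S] (hb : IsBlockGroup S) :
    IsBlockGroup (WithOne S) := by
  constructor
  · intro e f
    induction e with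
    | one => intro h _ _ _; simpa using h.symm
    | coe e =>
      induction f with
      | one => intro _ _ h _; simp at h
      | coe f =>
        intro h1 h2 h3 h4
        norm_cast at *
        exact hb.1 e f h1 h2 h3 h4
  · intro e f
    induction e with
    | one => intro _ _ h _; simpa using h.symm
    | coe e =>
      induction f with
      | one => intro h _ _ _; simp at h
      | coe f =>
        intro h1 h2 h3 h4
        norm_cast at *
        exact hb.2 e f h1 h2 h3 h4

theorem HasSolvableSubgroups.withOne {S : Type u} [Semigroup S] (hs : HasSolvableSubgroups S)
    (G : Type u) [Group G] (f : G →ₙ* WithOne S) (hf : Function.Injective f) :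
    Group.IsSolvable G := by
  by_cases h1 : ∃ g, f g = 1
  · obtain ⟨g, hg⟩ := h1
    have hone : ∀ x y : WithOne S, x * y = 1 → x = 1 := by
      intro x y
      induction x with
      | one => exact fun _ => rfl
      | coe x =>
        induction y with
        | one => intro h; simp at h
        | coe y => intro h; exact absurd h (by rw [← WithOne.coe_mul]; exact WithOne.coe_ne_one)
    have hall : ∀ x, f x = 1 := fun x => hone _ (f (x⁻¹ * g)) (by
      rw [← map_mul, mul_inv_cancel_left, hg])
    have : Subsingleton G := ⟨fun x y => hf ((hall x).trans (hall y).symm)⟩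
    infer_instance
  · push Not at h1
    have hex : ∀ g, ∃ s : S, (s : WithOne S) = f g := fun g => WithOne.ne_one_iff_exists.1 (h1 g)
    choose φ hφ using hex
    have hmul : ∀ x y, φ (x * y) = φ x * φ y := fun x y => by
      apply WithOne.coe_injective
      rw [WithOne.coe_mul, hφ, hφ, hφ, map_mul]
    let F : G →ₙ* S := ⟨φ, hmul⟩
    have hF : Function.Injective F := fun x y h => hf (by
      rw [← hφ, ← hφ]; exact congrArg _ h)
    exact hs (MulHom.srange F) G ⟨MulEquiv.ofBijective F.srangeRestrict
      ⟨fun x y h => hF (congrArg Subtype.val h), F.srangeRestrict_surjective⟩⟩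

/-- In a finite monoid, there are arbitrarily large exponents turning all elements into
idempotents. -/
theorem exists_idempotent_exponent (Mo : Type*) [Monoid Mo] [Finite Mo] :
    ∃ M, 2 ≤ M ∧ Nat.card Mo ≤ M ∧ ∀ x : Mo, x ^ M * x ^ M = x ^ M := by
  have := Fintype.ofFinite Mo
  set q := Nat.card Mo with hq
  have hself : q + 2 ≤ (q + 2).factorial := Nat.self_le_factorial _
  refine ⟨(q + 2).factorial, by omega, by omega, fun x => ?_⟩
  have hlt : Fintype.card Mo < Fintype.card (Fin (q + 1)) := by
    rw [Fintype.card_fin, ← Nat.card_eq_fintype_card]; omega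
  obtain ⟨i, j, hne, heq⟩ :=
    Fintype.exists_ne_map_eq_of_card_lt (fun j : Fin (q + 1) => x ^ (j : ℕ)) hlt
  wlog hij : i < j generalizing i j
  · exact this j i hne.symm heq.symm (lt_of_le_of_ne (not_lt.1 hij) hne.symm)
  obtain ⟨p, hp⟩ := Nat.exists_eq_add_of_lt (show (i : ℕ) < j from hij)
  have heq : x ^ (i : ℕ) = x ^ ((i : ℕ) + p + 1) := by rw [← hp]; exact heq
  have hper : ∀ c r, x ^ ((i : ℕ) + r) = x ^ ((i : ℕ) + r + (p + 1) * c) := by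
    intro c r
    induction c with
    | zero => simp
    | succ c ih =>
      calc x ^ ((i : ℕ) + r) = x ^ (i : ℕ) * x ^ (r + (p + 1) * c) := by
            rw [ih, ← pow_add]; congr 1; ring
        _ = x ^ ((i : ℕ) + p + 1) * x ^ (r + (p + 1) * c) := by rw [← heq]
        _ = _ := by rw [← pow_add]; congr 1; ring
  obtain ⟨c, hc⟩ : p + 1 ∣ (q + 2).factorial := Nat.dvd_factorial (by omega) (by omega)
  obtain ⟨r, hr⟩ := Nat.exists_eq_add_of_le (show (i : ℕ) ≤ (q + 2).factorial by omega)
  rw [← pow_add]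
  conv_lhs => rw [show (q + 2).factorial + (q + 2).factorial = (i : ℕ) + r + (p + 1) * c by omega]
  rw [← hper, ← hr]

/-- Sufficiently nested block words take only idempotent values in a finite block-group with
solvable subgroups. -/
theorem exists_nestedWord_idem {S : Type u} [AISemiring S] [Finite S] (hblock : IsBlockGroup S)
    (hsolv : HasSolvableSubgroups S) {M N m : ℕ} {W : ℕ → ℕ} (hM : 2 ≤ M)
    (hcard : Nat.card (WithOne S) ≤ M) (hid : ∀ x : WithOne S, x ^ M * x ^ M = x ^ M)
    (hW : IsBlockWord W M N) (hm : m + 1 = M * N) :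
    ∃ h, ∀ τ : ℕ → S, (nestedWord W m h id).eval τ =
      (nestedWord W m h id).eval τ * (nestedWord W m h id).eval τ := by
  have : Finite (WithOne S) := inferInstanceAs (Finite (Option S))
  let E : ℕ → Set (WithOne S) := fun h => Nat.rec Set.univ (fun _ X =>
    {x | ∃ a : ℕ → WithOne S, (∀ t, a t ∈ X) ∧ x = seqProd (fun i => a (W i)) (M * N)}) h
  have hEsucc : ∀ h, E (h + 1) =
    {x | ∃ a : ℕ → WithOne S, (∀ t, a t ∈ E h) ∧ x = seqProd (fun i => a (W i)) (M * N)} :=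
    fun _ => rfl
  have hanti : Antitone E := by
    refine antitone_nat_of_succ_le fun h => ?_
    induction h with
    | zero => exact fun _ _ => trivial
    | succ h ih =>
      rintro x ⟨a, ha, hx⟩
      exact ⟨a, fun t => ih (ha t), hx⟩
  obtain ⟨h, hstable⟩ : ∃ h, E h ⊆ E (h + 1) := by
    obtain ⟨h, h', hne, heq⟩ := Finite.exists_ne_map_eq_of_infinite E
    wlog hlt : h < h' generalizing h h'
    · exact this h' h hne.symm heq.symm (lt_of_le_of_ne (not_lt.1 hlt) hne.symm)
    exact ⟨h, heq ▸ hanti hlt⟩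
  have hmem : ∀ (h : ℕ) (g : ℕ → ℕ) (τ : ℕ → S),
      (((nestedWord W m h g).eval τ : S) : WithOne S) ∈ E h := by
    intro h
    induction h with
    | zero => exact fun _ _ => trivial
    | succ h ih =>
      intro g τ
      refine ⟨fun t => ((nestedWord W m h fun x => g (Nat.pair t x)).eval τ : S),
        fun t => ih _ _, ?_⟩
      rw [← hm]
      exact coe_eval_prodTerm τ _ m
  refine ⟨h, fun τ => ?_⟩
  have := hblock.withOne.blockWord_values_idem (fun G _ f hf => hsolv.withOne G f hf) hM hcard hid
    hW (E := E h) (fun x hx => hstable hx) _ (hmem h id τ)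
  rw [← WithOne.coe_mul] at this
  exact (WithOne.coe_injective this).symm

theorem mainTheorem4 {S : Type u} [AISemiring S] [Finite S]
    (hblock : IsBlockGroup S) (hsolv : HasSolvableSubgroups S)
    (hid : ∀ p ∈ identitiesOf S, p.HoldsIn BrandtMonoid) :
    ¬ HasFiniteIdentityBasis S := by
  rintro ⟨B, hfin, hBS, hbasis⟩
  have : Finite (WithOne S) := inferInstanceAs (Finite (Option S))
  obtain ⟨M, hM, hcard, hpow⟩ := exists_idempotent_exponent (WithOne S)
  obtain ⟨k, hk, hBk⟩ : ∃ k, 1 ≤ k ∧ ∀ p ∈ B, p.lhs.bound ≤ k ∧ p.rhs.bound ≤ k := by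
    refine ⟨hfin.toFinset.sup (fun p => max p.lhs.bound p.rhs.bound) + 1, by omega, fun p hp => ?_⟩
    have := Finset.le_sup (f := fun p : SemiringIdentity => max p.lhs.bound p.rhs.bound)
      (hfin.mem_toFinset.2 hp)
    omega
  obtain ⟨W, N, hN, hblockWord, hscat⟩ := exists_scattered_blockWord M k
  obtain ⟨m, hm⟩ := Nat.exists_eq_succ_of_ne_zero (Nat.mul_pos (by omega : 0 < M) hN).ne'
  obtain ⟨h, hh⟩ := exists_nestedWord_idem hblock hsolv hM hcard hpow hblockWord hm.symm
  rw [hm] at hscat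
  let hT := nestedRels_isSeparated hscat hk m.succ_pos h
  let := hT.semiring
  exact nestedWord_not_idem hscat hk h (hbasis
    ⟨nestedWord W m h id, .mul (nestedWord W m h id) (nestedWord W m h id)⟩ hh _
    fun p hp => hT.holdsIn (hBk p hp).1 (hBk p hp).2 (hid p (hBS hp)))
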